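/- **Setting.** Let $n\ge 2$, let $M$ be an $n$-dimensional smooth manifold and let $\psi:M\to\mathbb R^{n+1}$ be a smooth immersion that is a *centroaffine hypersurface*, i.e. at each point the position vector $\psi$ is transversal to the tangent hyperplane. Let $D$ be the standard flat connection of $\mathbb R^{n+1}$. For $\varepsilon\in\{1,-1\}$, the Gauss formula $$D_X\psi_*(Y)=\psi_*(\nabla_XY)+h(X,Y)(-\varepsilon\psi)$$ defines the induced connection $\nabla$ and the centroaffine metric $h$. Assume that $\psi$ is *locally strongly convex*, i.e. $h$ is definite, and choose $\varepsilon$ such that $h$ is positive definite. Let $\hat\nabla$ be the Levi-Civita connection of $h$, $K(X,Y)=\nabla_XY-\hat\nabla_XY$ the difference tensor and $C=\nabla h$ the cubic form; the cubic form is *parallel* if $\hat\nabla C=0$. For a centroaffine hypersurface $\psi_1:M_1\to\mathbb R^{n}$ of dimension $n-1$ and a constant $\lambda\neq 0,-1$, the *Calabi product of $\psi_1$ and a point* is $$\tilde\psi:\mathbb R\times M_1\to\mathbb R^{n}\times\mathbb R,\qquad \tilde\psi(u,p)=(e^{u}\psi_1(p),\,e^{-\lambda u}).$$ **Theorem.**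 Assume that $\hat\nabla K=0$ and that there are $h$-orthogonal distributions $\mathcal D_1$ (of dimension $1$, spanned by a smooth unit vector field $T$) and $\mathcal D_2$ (of dimension $n-1$) on $M$ and real functions $\lambda_1,\lambda_2$ on $M$ (for instance constants) such that at every point $$K(T,T)=\lambda_1T,\qquad K(T,V)=\lambda_2V\quad\text{for all }V\in\mathcal D_2,\qquad \lambda_1\neq2\lambda_2 .$$ Then $\psi$ can be locally decomposed as the Calabi product of a locally strongly convex centroaffine hypersurface with parallel cubic form and a point. That is, for every $p_0\in M$ there are an open neighbourhood $U$ of $p_0$, an open interval $I$, an $(n-1)$-dimensional locally strongly convex centroaffine hypersurface $\psi_1:M_1\to\mathbb R^{n}$ with parallel cubic form ($M_1$ an open subset of $\mathbb R^{n-1}$), a constant $\lambda\neq0,-1$, a diffeomorphism $\Phi:U\to I\times M_1$ and a linear isomorphism $A:\mathbb R^{n+1}\to\mathbb R^{n}\times\mathbb R$ such that $$A\psi(q)=(e^{u}\psi_1(p),\,e^{-\lambda u})\qquad\text{for all }q\in U,\ (u,p)=\Phi(q).$$ -/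

import Mathlib

open scoped Manifold ContDiff

noncomputable section

namespace Centroaffine

/-! ### Centroaffine geometry of a parametrized hypersurface

Here `f : E → F` is a smooth map on an open subset of `E`, viewed as a hypersurface in coordinates.
Vectors `v : E` stand for the constant coefficient (coordinate) vector fields, so that
`D_v f_*(w)` is the second derivative of `f` in the directions `v, w`. -/

section Local

variable {E F : Type*} [NormedAddCommGroup E] [NormedSpace ℝ E]
  [NormedAddCommGroup F] [NormedSpace ℝ F]

/-- The map `(v, t) ↦ df_x(v) + t f(x)`; it is bijective iff `f` is a centroaffine hypersurface
immersion at `x`. -/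
def frame (f : E → F) (x : E) : (E × ℝ) →L[ℝ] F :=
  (fderiv ℝ f x).coprod (ContinuousLinearMap.toSpanSingleton ℝ (f x))

/-- The centroaffine metric `h` induced by the centroaffine normal `-ε f` (where `ε = ±1`), that is,
the second part of the Gauss formula `D_v f_*(w) = f_*(∇_v w) + h(v, w) (-ε f)`. -/
def metric (ε : ℝ) (f : E → F) (x : E) : E →L[ℝ] E →L[ℝ] ℝ :=
  (-ε) • (ContinuousLinearMap.compL ℝ E F ℝ
    ((ContinuousLinearMap.snd ℝ E ℝ).comp (frame f x).inverse)).comp (fderiv ℝ (fderiv ℝ f) x)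

/-- The Christoffel symbol of the induced connection: `∇_v w` for coordinate vector fields `v, w`,
that is, the first part of the Gauss formula. -/
def inducedConn (f : E → F) (x : E) : E →L[ℝ] E →L[ℝ] E :=
  (ContinuousLinearMap.compL ℝ E F E
    ((ContinuousLinearMap.fst ℝ E ℝ).comp (frame f x).inverse)).comp (fderiv ℝ (fderiv ℝ f) x)

/-- The Christoffel symbol of the Levi-Civita connection `∇̂` of `h`, for coordinate vector fields:
`2 h(∇̂_v w, z) = ∂_v h(w, z) + ∂_w h(v, z) - ∂_z h(v, w)`. -/
def leviCivita (ε : ℝ) (f : E → F) (x : E) (v w : E) : E :=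
  let Dh := fderiv ℝ (metric ε f) x
  (1 / 2 : ℝ) • (metric ε f x).inverse (Dh v w + Dh w v - (Dh.flip v).flip w)

/-- The difference tensor `K(v, w) = ∇_v w - ∇̂_v w`. -/
def diffTensor (ε : ℝ) (f : E → F) (x : E) (v w : E) : E :=
  inducedConn f x v w - leviCivita ε f x v w

/-- `(∇̂_z K)(v, w)`. -/
def covDerivDiffTensor (ε : ℝ) (f : E → F) (x : E) (z v w : E) : E :=
  fderiv ℝ (fun y => diffTensor ε f y v w) x z + leviCivita ε f x z (diffTensor ε f x v w)
    - diffTensor ε f x (leviCivita ε f x z v) w - diffTensor ε f x v (leviCivita ε f x z w)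

/-- The cubic form `C = ∇h`, that is `C(u, v, w) = (∇_u h)(v, w)`. -/
def cubicForm (ε : ℝ) (f : E → F) (x : E) (u v w : E) : ℝ :=
  fderiv ℝ (fun y => metric ε f y v w) x u
    - metric ε f x (inducedConn f x u v) w - metric ε f x v (inducedConn f x u w)

/-- `(∇̂_z C)(u, v, w)`. -/
def covDerivCubicForm (ε : ℝ) (f : E → F) (x : E) (z u v w : E) : ℝ :=
  fderiv ℝ (fun y => cubicForm ε f y u v w) x z
    - cubicForm ε f x (leviCivita ε f x z u) v w
    - cubicForm ε f x u (leviCivita ε f x z v) w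
    - cubicForm ε f x u v (leviCivita ε f x z w)

/-- On the open set `U`, `f` is a locally strongly convex centroaffine hypersurface, with `ε = ±1`
chosen such that the centroaffine metric `h` is positive definite: `f` is a smooth immersion, `F` is
the direct sum of the tangent hyperplane and the line of the position vector at each point, and `h`
is positive definite. -/
structure IsConvexCentroaffineOn (ε : ℝ) (f : E → F) (U : Set E) : Prop where
  eps : ε = 1 ∨ ε = -1
  smooth : ContDiffOn ℝ ∞ f U
  immersion : ∀ x ∈ U, Function.Injective (fderiv ℝ f x)
  ne_zero : ∀ x ∈ U, f x ≠ 0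
  transversal : ∀ x ∈ U, IsCompl (fderiv ℝ f x).range (Submodule.span ℝ {f x})
  posDef : ∀ x ∈ U, ∀ v : E, v ≠ 0 → 0 < metric ε f x v v

/-- The (generalized) Calabi product `(u, p) ↦ (e^u f(p), e^{-c u})` of `f` and a point. -/
def calabiPoint (c : ℝ) (f : E → F) (a : ℝ × E) : F × ℝ :=
  (Real.exp a.1 • f a.2, Real.exp (-c * a.1))

end Local

/-! ### Hypersurfaces `ψ : M → F` on a smooth manifold, through the charts of `M` -/

section Global

variable {n : ℕ} {M : Type*} [TopologicalSpace M] [ChartedSpace (EuclideanSpace ℝ (Fin n)) M]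
  {F : Type*} [NormedAddCommGroup F] [NormedSpace ℝ F]

/-- `ψ` in the coordinates of the chart around `p`. -/
def coordRep (ψ : M → F) (p : M) : EuclideanSpace ℝ (Fin n) → F :=
  ψ ∘ (extChartAt (𝓡 n) p).symm

/-- The components of a tangent vector at `q` in the coordinates of the chart around `p`. -/
def coordVec (p q : M) (v : TangentSpace (𝓡 n) q) : EuclideanSpace ℝ (Fin n) :=
  mfderiv (𝓡 n) 𝓘(ℝ, EuclideanSpace ℝ (Fin n)) (extChartAt (𝓡 n) p) q v

/-- `ψ : M → F` is a locally strongly convex centroaffine hypersurface, with `ε = ±1` chosen such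
that the centroaffine metric is positive definite. -/
def IsConvexCentroaffine (ε : ℝ) (ψ : M → F) : Prop :=
  (ε = 1 ∨ ε = -1) ∧
    ∀ p : M, IsConvexCentroaffineOn ε (coordRep ψ p) (extChartAt (𝓡 n) p).target

/-- `∇̂K = 0` on `M`. -/
def HasParallelDiffTensor (ε : ℝ) (ψ : M → F) : Prop :=
  ∀ p : M, ∀ x ∈ (extChartAt (𝓡 n) p).target, ∀ z v w : EuclideanSpace ℝ (Fin n),
    covDerivDiffTensor ε (coordRep ψ p) x z v w = 0

/-- The centroaffine metric of `ψ` at `q`, evaluated on tangent vectors of `M` at `q` in the chart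
around `p` (the value does not depend on `p`). -/
def metricAt (ε : ℝ) (ψ : M → F) (p q : M) (v w : TangentSpace (𝓡 n) q) : ℝ :=
  metric ε (coordRep ψ p) (extChartAt (𝓡 n) p q) (coordVec p q v) (coordVec p q w)

/-- The components, in the chart around `p`, of `K(v, w)` for tangent vectors `v, w` of `M`
at `q`. -/
def diffTensorAt (ε : ℝ) (ψ : M → F) (p q : M) (v w : TangentSpace (𝓡 n) q) :
    EuclideanSpace ℝ (Fin n) :=
  diffTensor ε (coordRep ψ p) (extChartAt (𝓡 n) p q) (coordVec p q v) (coordVec p q w)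

end Global

/-- Around `p₀`, the hypersurface `ψ : M → ℝⁿ⁺¹` is, up to a linear isomorphism of `ℝⁿ⁺¹` with
`ℝⁿ × ℝ` and a diffeomorphism `Φ` from a neighbourhood of `p₀` onto a product of an open interval and
an open subset `V` of `ℝⁿ⁻¹`, the Calabi product of a point and a locally strongly convex centroaffine
hypersurface `ψ₁ : V → ℝⁿ` with parallel cubic form. -/
def IsCalabiProductWithPointNear {n : ℕ} {M : Type*} [TopologicalSpace M]
    [ChartedSpace (EuclideanSpace ℝ (Fin n)) M]
    (ψ : M → EuclideanSpace ℝ (Fin (n + 1))) (p₀ : M) : Prop :=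
  ∃ (c ε₁ a b : ℝ) (V : Set (EuclideanSpace ℝ (Fin (n - 1))))
    (ψ₁ : EuclideanSpace ℝ (Fin (n - 1)) → EuclideanSpace ℝ (Fin n))
    (A : EuclideanSpace ℝ (Fin (n + 1)) ≃L[ℝ] (EuclideanSpace ℝ (Fin n) × ℝ))
    (Φ : OpenPartialHomeomorph M (ℝ × EuclideanSpace ℝ (Fin (n - 1)))),
    c ≠ 0 ∧ c ≠ -1 ∧
    IsOpen V ∧ IsConvexCentroaffineOn ε₁ ψ₁ V ∧
    (∀ x ∈ V, ∀ z u v w : EuclideanSpace ℝ (Fin (n - 1)),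
      covDerivCubicForm ε₁ ψ₁ x z u v w = 0) ∧
    p₀ ∈ Φ.source ∧ Φ.target = Set.Ioo a b ×ˢ V ∧
    ContMDiffOn (𝓡 n) 𝓘(ℝ, ℝ × EuclideanSpace ℝ (Fin (n - 1))) ∞ Φ Φ.source ∧
    ContMDiffOn 𝓘(ℝ, ℝ × EuclideanSpace ℝ (Fin (n - 1))) (𝓡 n) ∞ Φ.symm Φ.target ∧
    ∀ q ∈ Φ.source, A (ψ q) = calabiPoint c ψ₁ (Φ q)

end Centroaffine

end

/-! Write `h` for the metric, `η = h(T, ·)`, `a`, `b` for the two eigenvalue functions and `μ = a -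
b`. Differentiate `K(T, T) = a T` with `∇̂K = 0`. Since `∇̂_z T` is orthogonal to `T`, this gives
`(2b - a) ∇̂_z T = da(z) T`, and `a ≠ 2b` forces `∇̂T = 0` and `da = 0` (`parallel_aux`).
Differentiating `K(T, v) = b v` for `v` orthogonal to `T` gives `db = 0` (`fderiv_snd`). Symmetry of
the second derivative of `f_* T` then yields `ε = b μ` (`eps_eq`), so `b`, `μ` and `μ - b = a - 2b`
are all nonzero.

The field `P = f_* T - b f` now satisfies `dP = μ η P`. It therefore keeps a fixed direction `w`,
and its length factor `g` satisfies `dg = μ g η`. Moreover `g` solves the Gauss equation of `f`, so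
`g = β ∘ f` for a linear functional `β` (`exists_eq_comp_of_gauss`, `exists_isPointSplitting`).
Splitting `F` along `w` and `ker β`, with `B` the projection that kills `w`, and setting `u = (b/μ)
log g`, one has `du = b η`, and `e^{-u} B f` is constant along `T`. Hence `f` corresponds to `(e^u
f₁, e^{(μ/b) u})`: a Calabi product with constant `-(μ/b)`.

The factor `f₁` is parametrized by the slice `u = 0`, which is orthogonal to the parallel field `T`
and hence totally geodesic. As `B` sends `f_* T` to `b B f`, the Gauss formula of `f` projects to
that of `f₁`, with `ε h` replaced by `(ε - b²) h`. The metric of `f₁` is thus a constant multiple of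
`h` on the slice, its Levi-Civita connection is the restricted one, its cubic form is a constant
multiple of the restricted `h(K(·,·),·)`, and parallelism is inherited
(`covDerivCubicForm_projection`). -/

namespace Centroaffine

set_option maxSynthPendingDepth 3
set_option linter.unusedSectionVars false

/-! ### Product rules for operator-valued maps. -/

section Calculus

variable {E G H : Type*} [NormedAddCommGroup E] [NormedSpace ℝ E]
  [NormedAddCommGroup G] [NormedSpace ℝ G] [NormedAddCommGroup H] [NormedSpace ℝ H]

theorem fderiv_clm_apply_apply {A : E → G →L[ℝ] H} {X : E → G} {x : E}
    (hA : DifferentiableAt ℝ A x) (hX : DifferentiableAt ℝ X x) (z : E) :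
    fderiv ℝ (fun y => A y (X y)) x z = fderiv ℝ A x z (X x) + A x (fderiv ℝ X x z) := by
  rw [(hA.hasFDerivAt.clm_apply hX.hasFDerivAt).fderiv]
  simp [add_comm]

theorem fderiv_bilin_apply {G' : Type*} [NormedAddCommGroup G'] [NormedSpace ℝ G']
    {B : E → G →L[ℝ] G' →L[ℝ] H} {X : E → G} {Y : E → G'} {x : E}
    (hB : DifferentiableAt ℝ B x) (hX : DifferentiableAt ℝ X x) (hY : DifferentiableAt ℝ Y x)
    (z : E) :
    fderiv ℝ (fun y => B y (X y) (Y y)) x z = fderiv ℝ B x z (X x) (Y x)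
      + B x (fderiv ℝ X x z) (Y x) + B x (X x) (fderiv ℝ Y x z) := by
  rw [fderiv_clm_apply_apply (hB.clm_apply hX) hY, fderiv_clm_apply_apply hB hX]
  simp

theorem fderiv_bilin_const {G' : Type*} [NormedAddCommGroup G'] [NormedSpace ℝ G']
    {B : E → G →L[ℝ] G' →L[ℝ] H} {x : E} (hB : DifferentiableAt ℝ B x) (v : G) (w : G') (z : E) :
    fderiv ℝ (fun y => B y v w) x z = fderiv ℝ B x z v w := by
  rw [fderiv_bilin_apply hB (differentiableAt_const v) (differentiableAt_const w)]
  simp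

theorem contDiffAt_fderiv_infty {f : E → G} {x : E} (h : ContDiffAt ℝ ∞ f x) :
    ContDiffAt ℝ ∞ (fderiv ℝ f) x :=
  h.fderiv_right (by simp)

theorem fderiv_fderiv_comm {f : E → G} {x : E} (h : ContDiffAt ℝ ∞ f x) (v w : E) :
    fderiv ℝ (fderiv ℝ f) x v w = fderiv ℝ (fderiv ℝ f) x w v :=
  (h.isSymmSndFDerivAt (by simpa using WithTop.coe_le_coe.2 (le_top (a := (2 : ℕ∞))))).eq v w

theorem differentiableAt_of_infty {f : E → G} {x : E} (h : ContDiffAt ℝ ∞ f x) :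
    DifferentiableAt ℝ f x :=
  h.differentiableAt (by simp)

end Calculus

/-! ### Gauss formula, Codazzi equation and symmetries of the difference tensor. -/

section Structure

variable {E F : Type*} [NormedAddCommGroup E] [NormedSpace ℝ E]
  [NormedAddCommGroup F] [NormedSpace ℝ F]

theorem frame_apply (f : E → F) (x v : E) (t : ℝ) :
    frame f x (v, t) = fderiv ℝ f x v + t • f x := by
  simp [frame]

theorem contDiffAt_frame {f : E → F} {x : E} (h : ContDiffAt ℝ ∞ f x) :
    ContDiffAt ℝ ∞ (frame f) x := by
  have h1 : ContDiffAt ℝ ∞ (fun y => (fderiv ℝ f y).comp (ContinuousLinearMap.fst ℝ E ℝ)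
      + (ContinuousLinearMap.toSpanSingletonCLE (𝕜 := ℝ) (f y)).comp
        (ContinuousLinearMap.snd ℝ E ℝ)) x := by
    refine ContDiffAt.add ?_ ?_
    · exact (contDiffAt_fderiv_infty h).clm_comp contDiffAt_const
    · exact ((ContinuousLinearMap.toSpanSingletonCLE (𝕜 := ℝ) (E := F)).contDiff.contDiffAt.comp x
        h).clm_comp contDiffAt_const
  refine h1.congr_of_eventuallyEq (Filter.Eventually.of_forall fun y => ?_)
  ext v <;> simp [frame]

theorem bijective_frame {f : E → F} {x : E} (hi : Function.Injective (fderiv ℝ f x))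
    (h0 : f x ≠ 0) (ht : IsCompl (fderiv ℝ f x).range (Submodule.span ℝ {f x})) :
    Function.Bijective (frame f x) := by
  constructor
  · rw [injective_iff_map_eq_zero]
    rintro ⟨v, t⟩ h
    rw [frame_apply] at h
    have h1 : fderiv ℝ f x v = 0 := by
      have := Submodule.disjoint_def.1 ht.disjoint (fderiv ℝ f x v) ⟨v, rfl⟩ (by
        rw [eq_neg_of_add_eq_zero_left h]
        exact Submodule.neg_mem _ (Submodule.smul_mem _ _ (Submodule.mem_span_singleton_self _)))
      exact this
    have h2 : v = 0 := hi (by simpa using h1)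
    rw [h1, zero_add, smul_eq_zero] at h
    simp [h2, h.resolve_right h0]
  · intro y
    have hy : y ∈ (fderiv ℝ f x).range ⊔ Submodule.span ℝ {f x} := by
      rw [ht.sup_eq_top]; trivial
    obtain ⟨a, ⟨v, rfl⟩, b, hb, rfl⟩ := Submodule.mem_sup.1 hy
    obtain ⟨t, rfl⟩ := Submodule.mem_span_singleton.1 hb
    exact ⟨(v, t), by rw [frame_apply]; rfl⟩

theorem isCompl_of_bijective_frame {f : E → F} {x : E} (h : Function.Bijective (frame f x)) :
    IsCompl (fderiv ℝ f x).range (Submodule.span ℝ {f x}) := by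
  constructor
  · rw [Submodule.disjoint_def]
    rintro _ ⟨v, rfl⟩ hb
    obtain ⟨t, ht⟩ := Submodule.mem_span_singleton.1 hb
    have : ((v, -t) : E × ℝ) = 0 := h.1 (by
      rw [frame_apply, map_zero, neg_smul, ht]; exact add_neg_cancel _)
    have hv : v = 0 := congrArg Prod.fst this
    simp [hv]
  · rw [codisjoint_iff, eq_top_iff]
    intro y _
    obtain ⟨⟨v, t⟩, rfl⟩ := h.2 y
    rw [frame_apply]
    exact Submodule.add_mem_sup ⟨v, rfl⟩
      (Submodule.smul_mem _ _ (Submodule.mem_span_singleton_self _))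

theorem isInvertible_of_bijective [FiniteDimensional ℝ E] [FiniteDimensional ℝ F] {A : E →L[ℝ] F}
    (h : Function.Bijective A) : A.IsInvertible :=
  ⟨(LinearEquiv.ofBijective A.toLinearMap h).toContinuousLinearEquiv, by ext; rfl⟩

/-- The Christoffel symbol of the Levi-Civita connection as a bilinear map. -/
noncomputable def leviCivitaL (ε : ℝ) (f : E → F) (x : E) : E →L[ℝ] E →L[ℝ] E :=
  let Dh := fderiv ℝ (metric ε f) x
  (1 / 2 : ℝ) • (ContinuousLinearMap.compL ℝ E (E →L[ℝ] ℝ) E (metric ε f x).inverse).comp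
    (Dh + Dh.flip
      - ((ContinuousLinearMap.flipₗᵢ ℝ E E ℝ : (E →L[ℝ] E →L[ℝ] ℝ) →L[ℝ] E →L[ℝ] E →L[ℝ] ℝ)).comp
        Dh.flip)

theorem leviCivitaL_apply (ε : ℝ) (f : E → F) (x v w : E) :
    leviCivitaL ε f x v w = leviCivita ε f x v w := by
  simp [leviCivitaL, leviCivita]

/-- The difference tensor as a bilinear map. -/
noncomputable def diffTensorL (ε : ℝ) (f : E → F) (x : E) : E →L[ℝ] E →L[ℝ] E :=
  inducedConn f x - leviCivitaL ε f x

theorem diffTensorL_apply (ε : ℝ) (f : E → F) (x v w : E) :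
    diffTensorL ε f x v w = diffTensor ε f x v w := by
  simp [diffTensorL, diffTensor, leviCivitaL_apply]

theorem inducedConn_eq (ε : ℝ) (f : E → F) (x v w : E) :
    inducedConn f x v w = leviCivitaL ε f x v w + diffTensorL ε f x v w := by
  simp [diffTensorL]

theorem metric_apply (ε : ℝ) (f : E → F) (x v w : E) :
    metric ε f x v w = -ε * ((frame f x).inverse (fderiv ℝ (fderiv ℝ f) x v w)).2 := by
  simp [metric]

theorem inducedConn_apply (f : E → F) (x v w : E) :
    inducedConn f x v w = ((frame f x).inverse (fderiv ℝ (fderiv ℝ f) x v w)).1 := by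
  simp [inducedConn]

variable [FiniteDimensional ℝ E] [FiniteDimensional ℝ F] {ε : ℝ} {f : E → F} {U : Set E}

/-- Uniqueness of the Gauss decomposition; it reads off the metric and the connection from any
formula of Gauss type. -/
theorem metric_eq_of_gauss (hε : ε = 1 ∨ ε = -1) {x : E} (hb : Function.Bijective (frame f x))
    {v w Z : E} {t : ℝ}
    (h : fderiv ℝ (fderiv ℝ f) x v w = fderiv ℝ f x Z - (ε * t) • f x) :
    metric ε f x v w = t ∧ inducedConn f x v w = Z := by
  have h1 : fderiv ℝ (fderiv ℝ f) x v w = frame f x (Z, -(ε * t)) := by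
    rw [h, frame_apply, neg_smul, sub_eq_add_neg]
  rw [metric_apply, inducedConn_apply, h1, (isInvertible_of_bijective hb).inverse_apply_self]
  refine ⟨?_, rfl⟩
  rcases hε with rfl | rfl <;> simp

namespace IsConvexCentroaffineOn

theorem mono {V : Set E} (hf : IsConvexCentroaffineOn ε f U) (h : V ⊆ U) :
    IsConvexCentroaffineOn ε f V :=
  ⟨hf.eps, hf.smooth.mono h, fun x hx => hf.immersion x (h hx), fun x hx => hf.ne_zero x (h hx),
    fun x hx => hf.transversal x (h hx), fun x hx => hf.posDef x (h hx)⟩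

theorem mul_self_eps (hf : IsConvexCentroaffineOn ε f U) : ε * ε = 1 := by
  rcases hf.eps with rfl | rfl <;> simp

theorem frame_bijective (hf : IsConvexCentroaffineOn ε f U) {x : E} (hx : x ∈ U) :
    Function.Bijective (frame f x) :=
  bijective_frame (hf.immersion x hx) (hf.ne_zero x hx) (hf.transversal x hx)

theorem frame_isInvertible (hf : IsConvexCentroaffineOn ε f U) {x : E} (hx : x ∈ U) :
    (frame f x).IsInvertible :=
  isInvertible_of_bijective (hf.frame_bijective hx)

theorem gauss (hf : IsConvexCentroaffineOn ε f U) {x : E} (hx : x ∈ U) (v w : E) :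
    fderiv ℝ (fderiv ℝ f) x v w
      = fderiv ℝ f x (inducedConn f x v w) - (ε * metric ε f x v w) • f x := by
  conv_lhs => rw [← (hf.frame_isInvertible hx).self_apply_inverse (fderiv ℝ (fderiv ℝ f) x v w)]
  rw [metric_apply, inducedConn_apply, ← mul_assoc, mul_neg, hf.mul_self_eps, neg_one_mul,
    neg_smul, sub_neg_eq_add, ← frame_apply]

theorem contDiffAt (hf : IsConvexCentroaffineOn ε f U) (hU : IsOpen U) {x : E} (hx : x ∈ U) :
    ContDiffAt ℝ ∞ f x :=
  hf.smooth.contDiffAt (hU.mem_nhds hx)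

theorem contDiffAt_frame_inverse (hf : IsConvexCentroaffineOn ε f U) (hU : IsOpen U) {x : E}
    (hx : x ∈ U) : ContDiffAt ℝ ∞ (fun y => (frame f y).inverse) x := by
  have : CompleteSpace (E × ℝ) := FiniteDimensional.complete ℝ _
  exact ContDiffAt.comp x (hf.frame_isInvertible hx).contDiffAt_map_inverse
    (contDiffAt_frame (hf.contDiffAt hU hx))

theorem contDiffAt_metric (hf : IsConvexCentroaffineOn ε f U) (hU : IsOpen U) {x : E}
    (hx : x ∈ U) : ContDiffAt ℝ ∞ (metric ε f) x := by
  refine (contDiffAt_const (c := -ε)).smul (ContDiffAt.clm_comp ?_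
    (contDiffAt_fderiv_infty (contDiffAt_fderiv_infty (hf.contDiffAt hU hx))))
  exact (ContinuousLinearMap.compL ℝ E F ℝ).contDiff.contDiffAt.comp x
    (contDiffAt_const.clm_comp (hf.contDiffAt_frame_inverse hU hx))

theorem contDiffAt_inducedConn (hf : IsConvexCentroaffineOn ε f U) (hU : IsOpen U) {x : E}
    (hx : x ∈ U) : ContDiffAt ℝ ∞ (inducedConn f) x := by
  refine ContDiffAt.clm_comp ?_
    (contDiffAt_fderiv_infty (contDiffAt_fderiv_infty (hf.contDiffAt hU hx)))
  exact (ContinuousLinearMap.compL ℝ E F E).contDiff.contDiffAt.comp x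
    (contDiffAt_const.clm_comp (hf.contDiffAt_frame_inverse hU hx))

theorem metric_comm (hf : IsConvexCentroaffineOn ε f U) (hU : IsOpen U) {x : E}
    (hx : x ∈ U) (v w : E) : metric ε f x v w = metric ε f x w v := by
  rw [metric_apply, metric_apply, fderiv_fderiv_comm (hf.contDiffAt hU hx)]

theorem inducedConn_comm (hf : IsConvexCentroaffineOn ε f U) (hU : IsOpen U) {x : E}
    (hx : x ∈ U) (v w : E) : inducedConn f x v w = inducedConn f x w v := by
  rw [inducedConn_apply, inducedConn_apply, fderiv_fderiv_comm (hf.contDiffAt hU hx)]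

theorem fderiv_metric_comm (hf : IsConvexCentroaffineOn ε f U) (hU : IsOpen U) {x : E}
    (hx : x ∈ U) (z v w : E) :
    fderiv ℝ (metric ε f) x z v w = fderiv ℝ (metric ε f) x z w v := by
  have hd := differentiableAt_of_infty (hf.contDiffAt_metric hU hx)
  rw [← fderiv_bilin_const hd, ← fderiv_bilin_const hd]
  refine congrArg (fun L : E →L[ℝ] ℝ => L z) (Filter.EventuallyEq.fderiv_eq ?_)
  filter_upwards [hU.mem_nhds hx] with y hy using hf.metric_comm hU hy v w

theorem eq_zero_of_metric (hf : IsConvexCentroaffineOn ε f U) {x : E} (hx : x ∈ U) {v : E}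
    (h : metric ε f x v v = 0) : v = 0 := by
  by_contra hv
  exact (hf.posDef x hx v hv).ne' h

theorem eq_of_metric (hf : IsConvexCentroaffineOn ε f U) {x : E} (hx : x ∈ U) {v w : E}
    (h : ∀ z, metric ε f x v z = metric ε f x w z) : v = w :=
  sub_eq_zero.1 (hf.eq_zero_of_metric hx (by simp [h]))

theorem metric_isInvertible (hf : IsConvexCentroaffineOn ε f U) {x : E} (hx : x ∈ U) :
    (metric ε f x).IsInvertible := by
  have hinj : Function.Injective (metric ε f x).toLinearMap := fun v w h =>
    hf.eq_of_metric hx fun z => congrArg (fun L : E →L[ℝ] ℝ => L z) h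
  refine isInvertible_of_bijective ⟨hinj, ?_⟩
  refine (LinearMap.injective_iff_surjective_of_finrank_eq_finrank ?_).1 hinj
  rw [← (LinearMap.toContinuousLinearMap (𝕜 := ℝ) (E := E) (F' := ℝ)).finrank_eq]
  exact (Subspace.dual_finrank_eq (K := ℝ) (V := E)).symm

theorem contDiffAt_leviCivitaL (hf : IsConvexCentroaffineOn ε f U) (hU : IsOpen U) {x : E}
    (hx : x ∈ U) : ContDiffAt ℝ ∞ (leviCivitaL ε f) x := by
  have : CompleteSpace E := FiniteDimensional.complete ℝ _
  have hD := contDiffAt_fderiv_infty (hf.contDiffAt_metric hU hx)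
  have hF : ContDiffAt ℝ ∞ (fun y => (fderiv ℝ (metric ε f) y).flip) x :=
    (ContinuousLinearMap.flipₗᵢ ℝ E E (E →L[ℝ] ℝ)).contDiff.contDiffAt.comp x hD
  refine (contDiffAt_const (c := (1 / 2 : ℝ))).smul (ContDiffAt.clm_comp ?_ ((hD.add hF).sub
    (contDiffAt_const.clm_comp hF)))
  refine (ContinuousLinearMap.compL ℝ E (E →L[ℝ] ℝ) E).contDiff.contDiffAt.comp x ?_
  exact ContDiffAt.comp x (hf.metric_isInvertible hx).contDiffAt_map_inverse
    (hf.contDiffAt_metric hU hx)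

theorem contDiffAt_diffTensorL (hf : IsConvexCentroaffineOn ε f U) (hU : IsOpen U) {x : E}
    (hx : x ∈ U) : ContDiffAt ℝ ∞ (diffTensorL ε f) x :=
  (hf.contDiffAt_inducedConn hU hx).sub (hf.contDiffAt_leviCivitaL hU hx)

/-- The Koszul formula. -/
theorem koszul (hf : IsConvexCentroaffineOn ε f U) {x : E} (hx : x ∈ U) (v w z : E) :
    metric ε f x (leviCivitaL ε f x v w) z = (1 / 2 : ℝ) * (fderiv ℝ (metric ε f) x v w z
      + fderiv ℝ (metric ε f) x w v z - fderiv ℝ (metric ε f) x z v w) := by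
  rw [leviCivitaL_apply, leviCivita, map_smul, (hf.metric_isInvertible hx).self_apply_inverse]
  simp

theorem leviCivitaL_comm (hf : IsConvexCentroaffineOn ε f U) (hU : IsOpen U) {x : E}
    (hx : x ∈ U) (v w : E) : leviCivitaL ε f x v w = leviCivitaL ε f x w v :=
  hf.eq_of_metric hx fun z => by
    rw [hf.koszul hx, hf.koszul hx, hf.fderiv_metric_comm hU hx z v w]; ring

theorem diffTensorL_comm (hf : IsConvexCentroaffineOn ε f U) (hU : IsOpen U) {x : E}
    (hx : x ∈ U) (v w : E) : diffTensorL ε f x v w = diffTensorL ε f x w v := by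
  simp only [diffTensorL, sub_apply, hf.leviCivitaL_comm hU hx v w,
    hf.inducedConn_comm hU hx v w]

theorem fderiv_metric (hf : IsConvexCentroaffineOn ε f U) (hU : IsOpen U) {x : E}
    (hx : x ∈ U) (z v w : E) : fderiv ℝ (metric ε f) x z v w
      = metric ε f x (leviCivitaL ε f x z v) w + metric ε f x v (leviCivitaL ε f x z w) := by
  rw [hf.metric_comm hU hx v, hf.koszul hx, hf.koszul hx, hf.fderiv_metric_comm hU hx w z v,
    hf.fderiv_metric_comm hU hx v z w, hf.fderiv_metric_comm hU hx z w v]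
  ring

/-- Symmetry of the third derivative of `f`, in its component along `f`. It says that `∇h` is
totally symmetric; the terms containing `Γ(z, v)` agree on both sides and are dropped. -/
theorem codazzi (hf : IsConvexCentroaffineOn ε f U) (hU : IsOpen U) {x : E}
    (hx : x ∈ U) (z v w : E) :
    fderiv ℝ (metric ε f) x z v w + metric ε f x z (inducedConn f x v w)
      = fderiv ℝ (metric ε f) x v z w + metric ε f x v (inducedConn f x z w) := by
  have hdf := contDiffAt_fderiv_infty (hf.contDiffAt hU hx)
  have key : ∀ z v, fderiv ℝ (fderiv ℝ (fderiv ℝ f)) x z v w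
      = fderiv ℝ (fderiv ℝ f) x z (inducedConn f x v w)
        + fderiv ℝ f x (fderiv ℝ (inducedConn f) x z v w)
        - ((ε * metric ε f x v w) • fderiv ℝ f x z
          + (ε * fderiv ℝ (metric ε f) x z v w) • f x) := by
    intro z v
    rw [← fderiv_bilin_const (differentiableAt_of_infty (contDiffAt_fderiv_infty hdf))]
    have h1 : (fun y => fderiv ℝ (fderiv ℝ f) y v w) =ᶠ[nhds x]
        fun y => fderiv ℝ f y (inducedConn f y v w) - (ε * metric ε f y v w) • f y := by
      filter_upwards [hU.mem_nhds hx] with y hy using hf.gauss hy v w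
    have d1 := differentiableAt_of_infty hdf
    have d2 := differentiableAt_of_infty (hf.contDiffAt_inducedConn hU hx)
    have d3 := differentiableAt_of_infty (hf.contDiffAt_metric hU hx)
    have d4 := differentiableAt_of_infty (hf.contDiffAt hU hx)
    have d5 : DifferentiableAt ℝ (fun y => inducedConn f y v w) x := by fun_prop
    have d6 : DifferentiableAt ℝ (fun y => metric ε f y v w) x := by fun_prop
    have d7 := (d6.const_mul ε).fun_smul d4
    rw [h1.fderiv_eq, fderiv_fun_sub (d1.clm_apply d5) d7,
      sub_apply, fderiv_clm_apply_apply d1 d5, fderiv_bilin_const d2,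
      fderiv_fun_smul (d6.const_mul ε) d4, fderiv_const_mul d6]
    simp [fderiv_bilin_const d3, mul_smul]
  have h := fderiv_fderiv_comm hdf z v
  have h2 := congrArg (fun L : E →L[ℝ] F => L w) h
  simp only [key, hf.gauss hx] at h2
  have h3 : frame f x (fderiv ℝ (inducedConn f) x z v w + inducedConn f x z (inducedConn f x v w)
        - (ε * metric ε f x v w) • z,
        -(ε * (fderiv ℝ (metric ε f) x z v w + metric ε f x z (inducedConn f x v w))))
      = frame f x (fderiv ℝ (inducedConn f) x v z w + inducedConn f x v (inducedConn f x z w)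
        - (ε * metric ε f x z w) • v,
        -(ε * (fderiv ℝ (metric ε f) x v z w + metric ε f x v (inducedConn f x z w)))) := by
    rw [frame_apply, frame_apply]
    simp only [map_add, map_sub, map_smul]
    linear_combination (norm := module) h2
  -- The tangential component of `h3` is the curvature equation, which is not needed.
  have h4 := congrArg Prod.snd ((hf.frame_bijective hx).1 h3)
  have hε : ε ≠ 0 := by rintro rfl; simpa using hf.mul_self_eps
  simp only [neg_inj] at h4
  exact mul_left_cancel₀ hε h4

/-- As `∇̂h = 0`, the Codazzi equation involves only the `K` part of `∇`. -/
theorem metric_diffTensorL_comm (hf : IsConvexCentroaffineOn ε f U) (hU : IsOpen U) {x : E}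
    (hx : x ∈ U) (u v w : E) :
    metric ε f x (diffTensorL ε f x u v) w = metric ε f x (diffTensorL ε f x u w) v := by
  have key : ∀ z v w, metric ε f x (diffTensorL ε f x z w) v
      = metric ε f x (diffTensorL ε f x v w) z := by
    intro z v w
    have h := hf.codazzi hU hx z v w
    rw [hf.fderiv_metric hU hx, hf.fderiv_metric hU hx, inducedConn_eq ε, inducedConn_eq ε,
      hf.leviCivitaL_comm hU hx v z, hf.metric_comm hU hx v, hf.metric_comm hU hx z,
      hf.metric_comm hU hx v, hf.metric_comm hU hx z] at h
    simp only [map_add, add_apply] at h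
    linarith
  rw [hf.diffTensorL_comm hU hx u v, hf.diffTensorL_comm hU hx u w]
  exact key v w u

/-- This is the bridge between `∇̂K` and `∇̂C`: with `∇̂h = 0`, the two `K` terms of `∇h` coincide
by total symmetry. -/
theorem cubicForm_eq (hf : IsConvexCentroaffineOn ε f U) (hU : IsOpen U) {x : E}
    (hx : x ∈ U) (u v w : E) : cubicForm ε f x u v w
      = -2 * metric ε f x (diffTensorL ε f x u v) w := by
  rw [cubicForm, fderiv_bilin_const (differentiableAt_of_infty (hf.contDiffAt_metric hU hx)),
    hf.fderiv_metric hU hx, inducedConn_eq ε, inducedConn_eq ε, hf.metric_comm hU hx v,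
    hf.metric_comm hU hx v]
  simp only [map_add, add_apply]
  rw [hf.metric_diffTensorL_comm hU hx u w v]
  ring

/-- The covariant derivative of the difference tensor in terms of the bundled tensor. -/
theorem fderiv_diffTensorL (hf : IsConvexCentroaffineOn ε f U) (hU : IsOpen U) {x : E}
    (hx : x ∈ U) (hK : ∀ z v w, covDerivDiffTensor ε f x z v w = 0) (z v w : E) :
    fderiv ℝ (diffTensorL ε f) x z v w = diffTensorL ε f x (leviCivitaL ε f x z v) w
      + diffTensorL ε f x v (leviCivitaL ε f x z w)
      - leviCivitaL ε f x z (diffTensorL ε f x v w) := by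
  have h := hK z v w
  simp only [covDerivDiffTensor, ← diffTensorL_apply, ← leviCivitaL_apply] at h
  rw [fderiv_bilin_const (differentiableAt_of_infty (hf.contDiffAt_diffTensorL hU hx))] at h
  linear_combination (norm := module) h

end IsConvexCentroaffineOn

end Structure

/-! ### The principal field is parallel, its eigenvalues are constant, and `ε = b (a - b)`. -/

section PrincipalField

variable {E F : Type*} [NormedAddCommGroup E] [NormedSpace ℝ E] [FiniteDimensional ℝ E]
  [NormedAddCommGroup F] [NormedSpace ℝ F] [FiniteDimensional ℝ F]
  {ε : ℝ} {f : E → F} {U : Set E} {T : E → E} {a b : E → ℝ}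

/-- The smooth unit vector field `T` satisfies `K(T, T) = a T`, and `K(T, V) = b V` for all `V`
orthogonal to `T`, with `a ≠ 2 b`. -/
structure IsPrincipalField (ε : ℝ) (f : E → F) (U : Set E) (T : E → E) (a b : E → ℝ) : Prop where
  smooth : ContDiffOn ℝ ∞ T U
  unit : ∀ x ∈ U, metric ε f x (T x) (T x) = 1
  eigen : ∀ x ∈ U, diffTensorL ε f x (T x) (T x) = a x • T x
  eigen_orth : ∀ x ∈ U, ∀ v, metric ε f x (T x) v = 0 → diffTensorL ε f x (T x) v = b x • v
  ne : ∀ x ∈ U, a x ≠ 2 * b x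

theorem exists_ne_zero_apply_eq_zero (hdim : 2 ≤ Module.finrank ℝ E) (η : E →L[ℝ] ℝ) :
    ∃ v, v ≠ 0 ∧ η v = 0 := by
  by_contra! h
  have hinj : Function.Injective η.toLinearMap := by
    rw [injective_iff_map_eq_zero]
    intro v hv
    by_contra hne
    exact h v hne hv
  have := LinearMap.finrank_le_finrank_of_injective hinj
  rw [Module.finrank_self] at this
  omega

namespace IsPrincipalField

theorem contDiffAt (hT : IsPrincipalField ε f U T a b) (hU : IsOpen U) {x : E} (hx : x ∈ U) :
    ContDiffAt ℝ ∞ T x :=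
  hT.smooth.contDiffAt (hU.mem_nhds hx)

/-- Split `v` into its `T` component and its orthogonal component. -/
theorem diffTensorL_eq (hT : IsPrincipalField ε f U T a b) {x : E} (hx : x ∈ U) (v : E) :
    diffTensorL ε f x (T x) v = b x • v + ((a x - b x) * metric ε f x (T x) v) • T x := by
  have h := hT.eigen_orth x hx (v - metric ε f x (T x) v • T x) (by simp [hT.unit x hx])
  rw [map_sub, map_smul, hT.eigen x hx] at h
  linear_combination (norm := module) h

theorem dual_diffTensorL (hT : IsPrincipalField ε f U T a b) (hf : IsConvexCentroaffineOn ε f U)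
    (hU : IsOpen U) {x : E} (hx : x ∈ U) (v w : E) :
    metric ε f x (T x) (diffTensorL ε f x v w) = b x * metric ε f x v w
      + (a x - b x) * metric ε f x (T x) v * metric ε f x (T x) w := by
  rw [hf.metric_comm hU hx, hf.metric_diffTensorL_comm hU hx, hf.diffTensorL_comm hU hx,
    hT.diffTensorL_eq hx]
  simp

/-- Differentiate `h(T, T) = 1`; the second argument is `∇̂_z T`. -/
theorem covDeriv_orth (hT : IsPrincipalField ε f U T a b) (hf : IsConvexCentroaffineOn ε f U)
    (hU : IsOpen U) {x : E} (hx : x ∈ U) (z : E) :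
    metric ε f x (T x) (fderiv ℝ T x z + leviCivitaL ε f x z (T x)) = 0 := by
  have d1 := differentiableAt_of_infty (hf.contDiffAt_metric hU hx)
  have d2 := differentiableAt_of_infty (hT.contDiffAt hU hx)
  have h1 : (fun y => metric ε f y (T y) (T y)) =ᶠ[nhds x] fun _ => 1 := by
    filter_upwards [hU.mem_nhds hx] with y hy using hT.unit y hy
  have h2 := congrArg (fun L : E →L[ℝ] ℝ => L z) h1.fderiv_eq
  simp only [fderiv_bilin_apply d1 d2 d2, hf.fderiv_metric hU hx] at h2
  rw [hf.metric_comm hU hx _ (T x), hf.metric_comm hU hx _ (T x)] at h2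
  simp at h2
  rw [map_add]
  linarith

/-- The eigenvalue functions carry no regularity assumption; here `a` is recovered as `h(K(T, T),
T)`. -/
theorem differentiableAt_fst (hT : IsPrincipalField ε f U T a b)
    (hf : IsConvexCentroaffineOn ε f U) (hU : IsOpen U) {x : E} (hx : x ∈ U) :
    DifferentiableAt ℝ a x := by
  have d1 := differentiableAt_of_infty (hf.contDiffAt_metric hU hx)
  have d2 := differentiableAt_of_infty (hT.contDiffAt hU hx)
  have d3 := differentiableAt_of_infty (hf.contDiffAt_diffTensorL hU hx)
  have h1 : a =ᶠ[nhds x] fun y => metric ε f y (diffTensorL ε f y (T y) (T y)) (T y) := by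
    filter_upwards [hU.mem_nhds hx] with y hy
    rw [hT.eigen y hy]
    simp [hT.unit y hy]
  rw [h1.differentiableAt_iff]
  fun_prop

/-- Differentiating `K(T, T) = a T` gives `2 K(T, Y) = da(z) T + a Y` with `Y = ∇̂_z T`, and `K(T,
Y) = b Y` because `Y` is orthogonal to `T`. The components along `T` and orthogonal to it vanish
separately. -/
theorem parallel_aux (hT : IsPrincipalField ε f U T a b) (hf : IsConvexCentroaffineOn ε f U)
    (hU : IsOpen U) {x : E} (hx : x ∈ U) (hK : ∀ z v w, covDerivDiffTensor ε f x z v w = 0)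
    (z : E) : fderiv ℝ T x z = -leviCivitaL ε f x z (T x) ∧ fderiv ℝ a x z = 0 := by
  have d0 := hT.differentiableAt_fst hf hU hx
  have d2 := differentiableAt_of_infty (hT.contDiffAt hU hx)
  have d3 := differentiableAt_of_infty (hf.contDiffAt_diffTensorL hU hx)
  have h1 : (fun y => diffTensorL ε f y (T y) (T y)) =ᶠ[nhds x] fun y => a y • T y := by
    filter_upwards [hU.mem_nhds hx] with y hy using hT.eigen y hy
  have h2 := congrArg (fun L : E →L[ℝ] E => L z) h1.fderiv_eq
  simp only [fderiv_bilin_apply d3 d2 d2, hf.fderiv_diffTensorL hU hx hK,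
    fderiv_fun_smul d0 d2, hT.eigen x hx] at h2
  set Y := fderiv ℝ T x z + leviCivitaL ε f x z (T x) with hY
  have horth : metric ε f x (T x) Y = 0 := hT.covDeriv_orth hf hU hx z
  have hKY := hT.eigen_orth x hx Y horth
  rw [hf.diffTensorL_comm hU hx _ (T x), hf.diffTensorL_comm hU hx _ (T x)] at h2
  have h3 : (2 * b x - a x) • Y = fderiv ℝ a x z • T x := by
    simp only [add_apply, smul_apply, ContinuousLinearMap.smulRight_apply, map_smul] at h2
    rw [hY, map_add, ← hY] at hKY
    rw [sub_smul, mul_smul, ← hKY, hY]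
    linear_combination (norm := module) h2
  have h4 := congrArg (metric ε f x (T x)) h3
  simp only [map_smul, horth, hT.unit x hx, smul_eq_mul, mul_zero, mul_one] at h4
  refine ⟨?_, h4.symm⟩
  rw [← h4, zero_smul, smul_eq_zero, sub_eq_zero] at h3
  exact eq_neg_of_add_eq_zero_left (h3.resolve_left fun h => hT.ne x hx h.symm)

/-- `T` is parallel. -/
theorem fderiv_field (hT : IsPrincipalField ε f U T a b) (hf : IsConvexCentroaffineOn ε f U)
    (hU : IsOpen U) {x : E} (hx : x ∈ U) (hK : ∀ z v w, covDerivDiffTensor ε f x z v w = 0)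
    (z : E) : fderiv ℝ T x z = -leviCivitaL ε f x z (T x) :=
  (hT.parallel_aux hf hU hx hK z).1

theorem fderiv_fst (hT : IsPrincipalField ε f U T a b) (hf : IsConvexCentroaffineOn ε f U)
    (hU : IsOpen U) {x : E} (hx : x ∈ U) (hK : ∀ z v w, covDerivDiffTensor ε f x z v w = 0) :
    fderiv ℝ a x = 0 := by
  ext z
  exact (hT.parallel_aux hf hU hx hK z).2

theorem differentiableAt_dual (hT : IsPrincipalField ε f U T a b)
    (hf : IsConvexCentroaffineOn ε f U) (hU : IsOpen U) {x : E} (hx : x ∈ U) :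
    DifferentiableAt ℝ (fun y => metric ε f y (T y)) x :=
  (differentiableAt_of_infty (hf.contDiffAt_metric hU hx)).clm_apply
    (differentiableAt_of_infty (hT.contDiffAt hU hx))

/-- The form dual to `T` is parallel. -/
theorem fderiv_dual (hT : IsPrincipalField ε f U T a b) (hf : IsConvexCentroaffineOn ε f U)
    (hU : IsOpen U) {x : E} (hx : x ∈ U) (hK : ∀ z v w, covDerivDiffTensor ε f x z v w = 0)
    (z v : E) : fderiv ℝ (fun y => metric ε f y (T y)) x z v
      = metric ε f x (T x) (leviCivitaL ε f x z v) := by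
  rw [fderiv_clm_apply_apply (differentiableAt_of_infty (hf.contDiffAt_metric hU hx))
    (differentiableAt_of_infty (hT.contDiffAt hU hx)), hT.fderiv_field hf hU hx hK,
    add_apply, hf.fderiv_metric hU hx]
  simp

/-- `b` is the Rayleigh quotient of `K(T, ·)` at the projection off `T` of a fixed vector `w`,
chosen so that the projection does not vanish near `x`; dimension at least two provides `w`. -/
theorem differentiableAt_snd (hT : IsPrincipalField ε f U T a b)
    (hf : IsConvexCentroaffineOn ε f U) (hU : IsOpen U) (hdim : 2 ≤ Module.finrank ℝ E)
    {x : E} (hx : x ∈ U) : DifferentiableAt ℝ b x := by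
  obtain ⟨w, hw, hw0⟩ := exists_ne_zero_apply_eq_zero hdim (metric ε f x (T x))
  have d1 := differentiableAt_of_infty (hf.contDiffAt_metric hU hx)
  have d2 := differentiableAt_of_infty (hT.contDiffAt hU hx)
  have d3 := differentiableAt_of_infty (hf.contDiffAt_diffTensorL hU hx)
  set q : E → E := fun y => w - metric ε f y (T y) w • T y with hq
  have dq : DifferentiableAt ℝ q x := by fun_prop
  have dn : DifferentiableAt ℝ (fun y => metric ε f y (q y) (q y)) x := by fun_prop
  have dm : DifferentiableAt ℝ (fun y => metric ε f y (diffTensorL ε f y (T y) (q y)) (q y)) x := by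
    fun_prop
  have hx0 : metric ε f x (q x) (q x) ≠ 0 := by
    simpa [hq, hw0] using (hf.posDef x hx w hw).ne'
  have h1 : b =ᶠ[nhds x] fun y => metric ε f y (diffTensorL ε f y (T y) (q y)) (q y)
      / metric ε f y (q y) (q y) := by
    filter_upwards [hU.mem_nhds hx, dn.continuousAt.eventually_ne hx0] with y hy hne
    rw [hT.eigen_orth y hy (q y) (by simp [hq, hT.unit y hy]), map_smul, smul_apply, smul_eq_mul,
      mul_div_cancel_right₀ _ hne]
  rw [h1.differentiableAt_iff]
  simp only [div_eq_mul_inv]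
  exact dm.mul (dn.inv hx0)

/-- Differentiate the formula for `K(T, v)` at a point where `η(v) = 0`. Since `K`, `T` and `η` are
parallel, everything cancels except `db(z) v`. -/
theorem fderiv_snd (hT : IsPrincipalField ε f U T a b) (hf : IsConvexCentroaffineOn ε f U)
    (hU : IsOpen U) (hdim : 2 ≤ Module.finrank ℝ E) {x : E} (hx : x ∈ U)
    (hK : ∀ z v w, covDerivDiffTensor ε f x z v w = 0) : fderiv ℝ b x = 0 := by
  obtain ⟨v, hv, hv0⟩ := exists_ne_zero_apply_eq_zero hdim (metric ε f x (T x))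
  have d1 := differentiableAt_of_infty (hf.contDiffAt_metric hU hx)
  have d2 := differentiableAt_of_infty (hT.contDiffAt hU hx)
  have d3 := differentiableAt_of_infty (hf.contDiffAt_diffTensorL hU hx)
  have da := hT.differentiableAt_fst hf hU hx
  have db := hT.differentiableAt_snd hf hU hdim hx
  have dη := hT.differentiableAt_dual hf hU hx
  have dηv : DifferentiableAt ℝ (fun y => metric ε f y (T y) v) x := by fun_prop
  have dab : DifferentiableAt ℝ (fun y => a y - b y) x := da.sub db
  have dp : DifferentiableAt ℝ (fun y => (a y - b y) * metric ε f y (T y) v) x := dab.mul dηv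
  ext z
  have h1 : (fun y => diffTensorL ε f y (T y) v) =ᶠ[nhds x]
      fun y => b y • v + ((a y - b y) * metric ε f y (T y) v) • T y := by
    filter_upwards [hU.mem_nhds hx] with y hy using hT.diffTensorL_eq hy v
  have h2 := congrArg (fun L : E →L[ℝ] E => L z) h1.fderiv_eq
  have e1 : fderiv ℝ (fun y => metric ε f y (T y) v) x z
      = metric ε f x (T x) (leviCivitaL ε f x z v) := by
    rw [fderiv_clm_apply_apply dη (differentiableAt_const v), hT.fderiv_dual hf hU hx hK]
    simp
  simp only [fderiv_bilin_apply d3 d2 (differentiableAt_const v),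
    hf.fderiv_diffTensorL hU hx hK, fderiv_fun_add (db.smul_const v) (dp.fun_smul d2),
    fderiv_fun_smul dp d2, fderiv_smul_const db, fderiv_fun_mul dab dηv,
    hT.fderiv_field hf hU hx hK, add_apply, smul_apply, ContinuousLinearMap.smulRight_apply,
    hT.diffTensorL_eq hx, hv0, e1, fderiv_const_apply, zero_apply, map_zero] at h2
  have h3 : fderiv ℝ b x z • v = 0 := by
    simp only [map_neg, neg_apply, smul_eq_mul, map_add, map_smul] at h2
    linear_combination (norm := module) -h2
  exact (smul_eq_zero.1 h3).resolve_right hv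

theorem exists_const (hT : IsPrincipalField ε f U T a b) (hf : IsConvexCentroaffineOn ε f U)
    (hU : IsOpen U) (hUc : IsPreconnected U) (hdim : 2 ≤ Module.finrank ℝ E)
    (hK : ∀ x ∈ U, ∀ z v w, covDerivDiffTensor ε f x z v w = 0) :
    ∃ a₀ b₀ : ℝ, IsPrincipalField ε f U T (fun _ => a₀) (fun _ => b₀) := by
  obtain ⟨a₀, ha⟩ := hU.exists_is_const_of_fderiv_eq_zero hUc
    (fun x hx => (hT.differentiableAt_fst hf hU hx).differentiableWithinAt)
    (fun x hx => hT.fderiv_fst hf hU hx (hK x hx))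
  obtain ⟨b₀, hb⟩ := hU.exists_is_const_of_fderiv_eq_zero hUc
    (fun x hx => (hT.differentiableAt_snd hf hU hdim hx).differentiableWithinAt)
    (fun x hx => hT.fderiv_snd hf hU hdim hx (hK x hx))
  refine ⟨a₀, b₀, hT.smooth, hT.unit, fun x hx => ?_, fun x hx v hv => ?_, fun x hx => ?_⟩
  · rw [hT.eigen x hx, ha x hx]
  · rw [hT.eigen_orth x hx v hv, hb x hx]
  · have := hT.ne x hx
    rwa [ha x hx, hb x hx] at this

section Const

variable {a b : ℝ}

/-- Since `∇̂T = 0`, the Gauss formula leaves only `f_* K(z, T) - ε η(z) f`. -/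
theorem fderiv_tangent (hT : IsPrincipalField ε f U T (fun _ => a) (fun _ => b))
    (hf : IsConvexCentroaffineOn ε f U) (hU : IsOpen U) {x : E} (hx : x ∈ U)
    (hK : ∀ z v w, covDerivDiffTensor ε f x z v w = 0) (z : E) :
    fderiv ℝ (fun y => fderiv ℝ f y (T y)) x z = b • fderiv ℝ f x z
      + metric ε f x (T x) z • ((a - b) • fderiv ℝ f x (T x) - ε • f x) := by
  rw [fderiv_clm_apply_apply
    (differentiableAt_of_infty (contDiffAt_fderiv_infty (hf.contDiffAt hU hx)))
    (differentiableAt_of_infty (hT.contDiffAt hU hx)), hT.fderiv_field hf hU hx hK,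
    hf.gauss hx, inducedConn_eq ε, hf.diffTensorL_comm hU hx, hT.diffTensorL_eq hx,
    hf.metric_comm hU hx z]
  simp only [map_add, map_neg, map_smul]
  module

/-- Integrability condition of the system in `fderiv_tangent`: the second derivative of `f_* T` in
the directions `T` and `v`, with `v` orthogonal to `T`, is symmetric only if `(b (a - b) - ε) f_* v
= 0`. -/
theorem eps_eq (hT : IsPrincipalField ε f U T (fun _ => a) (fun _ => b))
    (hf : IsConvexCentroaffineOn ε f U) (hU : IsOpen U) (hdim : 2 ≤ Module.finrank ℝ E)
    {x : E} (hx : x ∈ U) (hK : ∀ x ∈ U, ∀ z v w, covDerivDiffTensor ε f x z v w = 0) :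
    ε = b * (a - b) := by
  obtain ⟨v, hv, hv0⟩ := exists_ne_zero_apply_eq_zero hdim (metric ε f x (T x))
  have hdf := contDiffAt_fderiv_infty (hf.contDiffAt hU hx)
  have hX : ContDiffAt ℝ ∞ (fun y => fderiv ℝ f y (T y)) x := hdf.clm_apply (hT.contDiffAt hU hx)
  have dη := hT.differentiableAt_dual hf hU hx
  have dX := differentiableAt_of_infty hX
  have df := differentiableAt_of_infty (hf.contDiffAt hU hx)
  have dW : DifferentiableAt ℝ (fun y => (a - b) • fderiv ℝ f y (T y) - ε • f y) x :=
    (dX.fun_const_smul _).fun_sub (df.fun_const_smul _)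
  have key : ∀ w z, fderiv ℝ (fderiv ℝ (fun y => fderiv ℝ f y (T y))) x w z
      = b • fderiv ℝ (fderiv ℝ f) x w z + (metric ε f x (T x) (leviCivitaL ε f x w z)
          • ((a - b) • fderiv ℝ f x (T x) - ε • f x)
        + metric ε f x (T x) z • ((a - b) • (b • fderiv ℝ f x w
      + metric ε f x (T x) w • ((a - b) • fderiv ℝ f x (T x) - ε • f x)) - ε • fderiv ℝ f x w)) := by
    intro w z
    have h1 : (fun y => fderiv ℝ (fun y => fderiv ℝ f y (T y)) y z) =ᶠ[nhds x] fun y =>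
        b • fderiv ℝ f y z + metric ε f y (T y) z • ((a - b) • fderiv ℝ f y (T y) - ε • f y) := by
      filter_upwards [hU.mem_nhds hx] with y hy using hT.fderiv_tangent hf hU hy (hK y hy) z
    have h2 := congrArg (fun L : E →L[ℝ] F => L w) h1.fderiv_eq
    have ddf := differentiableAt_of_infty hdf
    have ddX := differentiableAt_of_infty (contDiffAt_fderiv_infty hX)
    have d1 : DifferentiableAt ℝ (fun y => fderiv ℝ f y z) x := by fun_prop
    have d2 : DifferentiableAt ℝ (fun y => metric ε f y (T y) z) x := by fun_prop
    simp only [fderiv_clm_apply_apply ddX (differentiableAt_const z),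
      fderiv_fun_add (d1.fun_const_smul b) (d2.fun_smul dW), fderiv_fun_const_smul d1,
      fderiv_fun_smul d2 dW, fderiv_fun_sub (dX.fun_const_smul (a - b)) (df.fun_const_smul ε),
      fderiv_fun_const_smul dX, fderiv_fun_const_smul df, add_apply, smul_apply, sub_apply,
      ContinuousLinearMap.smulRight_apply, fderiv_clm_apply_apply ddf (differentiableAt_const z),
      fderiv_clm_apply_apply dη (differentiableAt_const z), hT.fderiv_dual hf hU hx (hK x hx),
      hT.fderiv_tangent hf hU hx (hK x hx), fderiv_const_apply, zero_apply, map_zero,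
      add_zero] at h2
    linear_combination (norm := module) h2
  have h := fderiv_fderiv_comm hX v (T x)
  rw [key, key, hv0, hT.unit x hx, fderiv_fderiv_comm (hf.contDiffAt hU hx) v,
    hf.leviCivitaL_comm hU hx v] at h
  have h3 : ((a - b) * b - ε) • fderiv ℝ f x v = 0 := by
    linear_combination (norm := module) h
  have h4 : fderiv ℝ f x v ≠ 0 := fun h0 => hv (hf.immersion x hx (by simpa using h0))
  have := (smul_eq_zero.1 h3).resolve_right h4
  linarith

end Const

end IsPrincipalField

end PrincipalField

/-! ### The fixed direction and the linear functional that split off the point. -/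

section Splitting

variable {E F : Type*} [NormedAddCommGroup E] [NormedSpace ℝ E] [FiniteDimensional ℝ E]
  [NormedAddCommGroup F] [NormedSpace ℝ F] [FiniteDimensional ℝ F]
  {ε : ℝ} {f : E → F} {U : Set E} {T : E → E}

theorem fderiv_frame {k : E → F} {x : E} (hk : ContDiffAt ℝ ∞ k x) (z v : E) (t : ℝ) :
    fderiv ℝ (frame k) x z (v, t) = fderiv ℝ (fderiv ℝ k) x z v + t • fderiv ℝ k x z := by
  have d1 := differentiableAt_of_infty (contDiffAt_fderiv_infty hk)
  have d2 := differentiableAt_of_infty hk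
  have h1 := fderiv_clm_apply_apply (differentiableAt_of_infty (contDiffAt_frame hk))
    (differentiableAt_const ((v, t) : E × ℝ)) z
  have d3 : DifferentiableAt ℝ (fun y => fderiv ℝ k y v) x := by fun_prop
  simp only [frame_apply, fderiv_fun_add d3 (d2.fun_const_smul t), fderiv_fun_const_smul d2,
    fderiv_const_apply, zero_apply, map_zero, add_zero, add_apply, smul_apply,
    fderiv_clm_apply_apply d1 (differentiableAt_const v)] at h1
  exact h1.symm

/-- A solution of the Gauss equation of `f` is a linear image of `f`. -/
theorem IsConvexCentroaffineOn.exists_eq_comp_of_gauss {F' : Type*} [NormedAddCommGroup F']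
    [NormedSpace ℝ F'] [FiniteDimensional ℝ F'] (hf : IsConvexCentroaffineOn ε f U) (hU : IsOpen U)
    (hUc : IsPreconnected U) {g : E → F'} (hg : ContDiffOn ℝ ∞ g U)
    (h : ∀ x ∈ U, ∀ v w, fderiv ℝ (fderiv ℝ g) x v w
      = fderiv ℝ g x (inducedConn f x v w) - (ε * metric ε f x v w) • g x) :
    ∃ β : F →L[ℝ] F', ∀ x ∈ U, β (f x) = g x := by
  -- `B` carries the frame of `f` to that of `g`. Both frames obey the same first-order linear
  -- system, so `B` is constant.
  set B : E → F →L[ℝ] F' := fun y => (frame g y).comp (frame f y).inverse with hB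
  have hBf : ∀ y ∈ U, ∀ e, B y (frame f y e) = frame g y e := fun y hy e => by
    simp [hB, (hf.frame_isInvertible hy).inverse_apply_self]
  have hgc : ∀ x ∈ U, ContDiffAt ℝ ∞ g x := fun x hx => hg.contDiffAt (hU.mem_nhds hx)
  have hBc : ∀ x ∈ U, DifferentiableAt ℝ B x := fun x hx =>
    differentiableAt_of_infty ((contDiffAt_frame (hgc x hx)).clm_comp
      (hf.contDiffAt_frame_inverse hU hx))
  have hB0 : ∀ x ∈ U, fderiv ℝ B x = 0 := by
    intro x hx
    ext z y
    obtain ⟨⟨v, t⟩, rfl⟩ := (hf.frame_bijective hx).2 y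
    have h1 : (fun y => B y (frame f y (v, t))) =ᶠ[nhds x] fun y => frame g y (v, t) := by
      filter_upwards [hU.mem_nhds hx] with y hy using hBf y hy _
    have h2 := congrArg (fun L : E →L[ℝ] F' => L z) h1.fderiv_eq
    have df := differentiableAt_of_infty (contDiffAt_frame (hf.contDiffAt hU hx))
    have dg := differentiableAt_of_infty (contDiffAt_frame (hgc x hx))
    have dfe : DifferentiableAt ℝ (fun y => frame f y (v, t)) x := by fun_prop
    simp only [fderiv_clm_apply_apply (hBc x hx) dfe,
      fderiv_clm_apply_apply df (differentiableAt_const ((v, t) : E × ℝ)),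
      fderiv_clm_apply_apply dg (differentiableAt_const ((v, t) : E × ℝ)),
      fderiv_frame (hf.contDiffAt hU hx), fderiv_frame (hgc x hx), fderiv_const_apply, zero_apply,
      map_zero, add_zero] at h2
    have h3 : fderiv ℝ (fderiv ℝ f) x z v + t • fderiv ℝ f x z
        = frame f x (inducedConn f x z v + t • z, -(ε * metric ε f x z v)) := by
      rw [hf.gauss hx, frame_apply, map_add, map_smul]
      module
    rw [h3, hBf x hx, h x hx, frame_apply g, map_add, map_smul] at h2
    simp only [zero_apply]
    linear_combination (norm := module) h2
  obtain ⟨β, hβ⟩ := hU.exists_is_const_of_fderiv_eq_zero hUc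
    (fun x hx => (hBc x hx).differentiableWithinAt) hB0
  refine ⟨β, fun x hx => ?_⟩
  -- The frame vector with parameter `(0, 1)` is the position vector itself.
  have := hBf x hx (0, 1)
  rwa [hβ x hx, frame_apply, frame_apply, map_zero, map_zero, zero_add, zero_add, one_smul,
    one_smul] at this

/-- The position function `g` along `T`, the constant direction `w` and the functional `β` that
together split off the point factor of the hypersurface. -/
structure IsPointSplitting (ε : ℝ) (f : E → F) (T : E → E) (μ b : ℝ) (W : Set E) (g : E → ℝ)
    (w : F) (β : F →L[ℝ] ℝ) : Prop where
  smooth : ContDiffOn ℝ ∞ g W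
  pos : ∀ x ∈ W, 0 < g x
  fderiv_eq : ∀ x ∈ W, ∀ v, fderiv ℝ g x v = μ * g x * metric ε f x (T x) v
  tangent : ∀ x ∈ W, fderiv ℝ f x (T x) = b • f x + ((μ - b) * g x) • w
  apply_dir : β w = 1
  apply_pos : ∀ x ∈ W, β (f x) = g x

/-- With `ε = b μ`, the field `P = f_* T - b f` satisfies `dP = μ η P`, so locally it is a positive
function times a constant vector. -/
theorem IsPrincipalField.exists_isPointSplitting {a b : ℝ}
    (hT : IsPrincipalField ε f U T (fun _ => a) (fun _ => b))
    (hf : IsConvexCentroaffineOn ε f U) (hU : IsOpen U) (hε : ε = b * (a - b))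
    (hK : ∀ x ∈ U, ∀ z v w, covDerivDiffTensor ε f x z v w = 0) {x₀ : E} (hx₀ : x₀ ∈ U) :
    ∃ (W : Set E) (g : E → ℝ) (w : F) (β : F →L[ℝ] ℝ), IsOpen W ∧ x₀ ∈ W ∧ W ⊆ U ∧ g x₀ = 1 ∧
      IsPointSplitting ε f T (a - b) b W g w β := by
  set μ := a - b with hμ
  have hμb : μ - b ≠ 0 := fun h => hT.ne x₀ hx₀ (by linarith)
  set P : E → F := fun y => fderiv ℝ f y (T y) - b • f y with hP
  have hPc : ∀ x ∈ U, ContDiffAt ℝ ∞ P x := fun x hx =>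
    ((contDiffAt_fderiv_infty (hf.contDiffAt hU hx)).clm_apply (hT.contDiffAt hU hx)).sub
      ((hf.contDiffAt hU hx).const_smul b)
  have hdP : ∀ x ∈ U, ∀ z, fderiv ℝ P x z = (μ * metric ε f x (T x) z) • P x := by
    intro x hx z
    have d1 := differentiableAt_of_infty
      ((contDiffAt_fderiv_infty (hf.contDiffAt hU hx)).clm_apply (hT.contDiffAt hU hx))
    have d2 := differentiableAt_of_infty (hf.contDiffAt hU hx)
    rw [hP, fderiv_fun_sub d1 (d2.fun_const_smul b), fderiv_fun_const_smul d2, sub_apply,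
      hT.fderiv_tangent hf hU hx (hK x hx), hε, smul_apply]
    module
  have hP0 : P x₀ ≠ 0 := by
    intro h0
    have h1 : frame f x₀ (T x₀, -b) = 0 := by
      rw [frame_apply, neg_smul, ← sub_eq_add_neg]; exact h0
    have h2 : T x₀ = 0 := congrArg Prod.fst ((hf.frame_bijective hx₀).1 (h1.trans (map_zero _).symm))
    have h3 := hT.unit x₀ hx₀
    rw [h2] at h3
    simp at h3
  obtain ⟨φ, hφ⟩ := SeparatingDual.exists_eq_one (R := ℝ) hP0
  set g : E → ℝ := fun y => φ (P y) with hg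
  have hgc : ∀ x ∈ U, ContDiffAt ℝ ∞ g x := fun x hx =>
    φ.contDiff.contDiffAt.comp x (hPc x hx)
  have hdg : ∀ x ∈ U, ∀ z, fderiv ℝ g x z = μ * g x * metric ε f x (T x) z := by
    intro x hx z
    have := (φ.hasFDerivAt.comp x (differentiableAt_of_infty (hPc x hx)).hasFDerivAt).fderiv
    rw [show g = φ ∘ P from rfl, this]
    simp [hdP x hx]
    ring
  have hnhds : {x | x ∈ U ∧ 0 < g x} ∈ nhds x₀ := by
    filter_upwards [hU.mem_nhds hx₀, (hgc x₀ hx₀).continuousAt.eventually (lt_mem_nhds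
      (show (0 : ℝ) < g x₀ by simp [hg, hφ]))] with y h1 h2 using ⟨h1, h2⟩
  obtain ⟨r, hr, hW⟩ := Metric.mem_nhds_iff.1 hnhds
  have hWc : IsPreconnected (Metric.ball x₀ r) := (convex_ball x₀ r).isPreconnected
  have hWU : Metric.ball x₀ r ⊆ U := fun x hx => (hW hx).1
  have hx₀W := Metric.mem_ball_self (x := x₀) hr
  have hPg : ∀ x ∈ Metric.ball x₀ r, P x = g x • P x₀ := by
    -- `P` and `g` have the same logarithmic derivative `μ η`, so `P / g` is constant.
    obtain ⟨q, hq⟩ := Metric.isOpen_ball.exists_is_const_of_fderiv_eq_zero (f := fun y => (g y)⁻¹ • P y) hWc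
      (fun x hx => (((differentiableAt_of_infty (hgc x (hWU hx))).inv (hW hx).2.ne').smul
        (differentiableAt_of_infty (hPc x (hWU hx)))).differentiableWithinAt)
      (fun x hx => by
        have d1 := differentiableAt_of_infty (hgc x (hWU hx))
        have d2 := differentiableAt_of_infty (hPc x (hWU hx))
        have hne := (hW hx).2.ne'
        ext z
        have d3 : HasFDerivAt (fun y => (g y)⁻¹) (-(g x ^ 2)⁻¹ • fderiv ℝ g x) x :=
          (hasDerivAt_inv hne).comp_hasFDerivAt x d1.hasFDerivAt
        rw [fderiv_fun_smul d3.differentiableAt d2, d3.fderiv]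
        simp only [add_apply, smul_apply, ContinuousLinearMap.smulRight_apply, hdP x (hWU hx),
          hdg x (hWU hx), smul_smul, ← add_smul, smul_eq_mul]
        rw [Pi.zero_apply, zero_apply]
        convert zero_smul ℝ _ using 2
        field_simp
        ring)
    intro x hx
    have h1 := hq x hx
    have h2 := hq x₀ hx₀W
    simp only [hg, hφ, inv_one, one_smul] at h2
    rw [h2, ← h1, smul_inv_smul₀ (hW hx).2.ne']
  have hgW : ContDiffOn ℝ ∞ g (Metric.ball x₀ r) := fun x hx => (hgc x (hWU hx)).contDiffWithinAt
  -- Since `η` is parallel, the second derivative of `g` is `μ² g η(v) η(w) + μ g η(∇̂_v w)`. This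
  -- matches the Gauss equation through `η(K(v, w)) = b h(v, w) + μ η(v) η(w)` and `ε = b μ`.
  obtain ⟨β, hβ⟩ := (hf.mono hWU).exists_eq_comp_of_gauss Metric.isOpen_ball hWc hgW (by
    intro x hx v w
    have hxU := hWU hx
    have d1 := differentiableAt_of_infty (hgc x hxU)
    have d2 := differentiableAt_of_infty (contDiffAt_fderiv_infty (hgc x hxU))
    have d3 := hT.differentiableAt_dual hf hU hxU
    have d4 : DifferentiableAt ℝ (fun y => metric ε f y (T y) w) x := by fun_prop
    have d5 : DifferentiableAt ℝ (fun y => μ * g y) x := d1.const_mul μ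
    have h1 : (fun y => fderiv ℝ g y w) =ᶠ[nhds x] fun y => μ * g y * metric ε f y (T y) w := by
      filter_upwards [hU.mem_nhds hxU] with y hy using hdg y hy w
    have h2 := congrArg (fun L : E →L[ℝ] ℝ => L v) h1.fderiv_eq
    simp only [fderiv_clm_apply_apply d2 (differentiableAt_const w), fderiv_fun_mul d5 d4,
      fderiv_const_mul d1, add_apply, smul_apply, hdg x hxU, smul_eq_mul,
      fderiv_clm_apply_apply d3 (differentiableAt_const w), hT.fderiv_dual hf hU hxU (hK x hxU),
      fderiv_const_apply, zero_apply, map_zero, mul_zero, add_zero] at h2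
    rw [h2, hdg x hxU, inducedConn_eq ε, map_add, hT.dual_diffTensorL hf hU hxU, hε, smul_eq_mul]
    ring)
  -- The factor `(μ - b)⁻¹` normalizes `β w = 1`: at `x₀`, `β(P) = dg(T) - b g = μ - b`.
  refine ⟨Metric.ball x₀ r, g, (μ - b)⁻¹ • P x₀, β, Metric.isOpen_ball, hx₀W, hWU, hφ, hgW,
    fun x hx => (hW hx).2, fun x hx => hdg x (hWU hx), fun x hx => ?_, ?_, hβ⟩
  · have := hPg x hx
    rw [smul_smul, mul_right_comm, mul_inv_cancel₀ hμb, one_mul, ← this]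
    simp [hP]
  · have h1 : β (fderiv ℝ f x₀ (T x₀)) = μ := by
      have h2 : (β ∘ f) =ᶠ[nhds x₀] g := by
        filter_upwards [Metric.isOpen_ball.mem_nhds hx₀W] with y hy using hβ y hy
      have h3 := congrArg (fun L : E →L[ℝ] ℝ => L (T x₀)) h2.fderiv_eq
      have h4 := (β.hasFDerivAt.comp x₀
        (differentiableAt_of_infty (hf.contDiffAt hU hx₀)).hasFDerivAt).fderiv
      simp only [h4, hdg x₀ hx₀, hT.unit x₀ hx₀] at h3
      simpa [hg, hφ] using h3
    rw [map_smul, hP, map_sub, map_smul, h1, hβ x₀ hx₀W]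
    simp [hg, hφ, inv_mul_cancel₀ hμb]

end Splitting

/-! ### Geometry of the orthogonal slice and of its projection. -/

section Slice

variable {E F E₁ F₁ : Type*} [NormedAddCommGroup E] [NormedSpace ℝ E] [FiniteDimensional ℝ E]
  [NormedAddCommGroup F] [NormedSpace ℝ F] [FiniteDimensional ℝ F]
  [NormedAddCommGroup E₁] [NormedSpace ℝ E₁] [FiniteDimensional ℝ E₁]
  [NormedAddCommGroup F₁] [NormedSpace ℝ F₁] [FiniteDimensional ℝ F₁]
  {ε : ℝ} {f : E → F} {U : Set E} {T : E → E} {a b : ℝ}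

/-- The Koszul formula determines any torsion-free metric connection. -/
theorem IsConvexCentroaffineOn.leviCivitaL_unique (hf : IsConvexCentroaffineOn ε f U)
    (hU : IsOpen U) {x : E} (hx : x ∈ U) {Γ : E → E → E} (hs : ∀ v w, Γ v w = Γ w v)
    (h : ∀ z v w, fderiv ℝ (metric ε f) x z v w
      = metric ε f x (Γ z v) w + metric ε f x v (Γ z w)) (v w : E) :
    leviCivitaL ε f x v w = Γ v w :=
  hf.eq_of_metric hx fun z => by
    rw [hf.koszul hx, h, h, h, hs w v, hs z v, hs z w, hf.metric_comm hU hx v (Γ w z),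
      hf.metric_comm hU hx w (Γ v z)]
    ring

/-- `ι` parametrizes a hypersurface of `U` orthogonal to `T`. -/
structure IsOrthogonalSlice (ε : ℝ) (f : E → F) (U : Set E) (T : E → E) (V : Set E₁)
    (ι : E₁ → E) : Prop where
  smooth : ContDiffOn ℝ ∞ ι V
  mapsTo : ∀ p ∈ V, ι p ∈ U
  immersion : ∀ p ∈ V, Function.Injective (fderiv ℝ ι p)
  mem_range_iff : ∀ p ∈ V, ∀ e, e ∈ Set.range (fderiv ℝ ι p) ↔ metric ε f (ι p) (T (ι p)) e = 0

/-- `B` is, along the slice `ι`, a projection whose kernel is spanned by `f_* T - b f`. -/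
structure IsSliceProjection (f : E → F) (T : E → E) (b : ℝ) (V : Set E₁) (ι : E₁ → E)
    (B : F →L[ℝ] F₁) : Prop where
  tangent : ∀ p ∈ V, B (fderiv ℝ f (ι p) (T (ι p))) = b • B (f (ι p))
  ker : ∀ p ∈ V, ∀ y, B y = 0 → ∃ t : ℝ, y = t • (fderiv ℝ f (ι p) (T (ι p)) - b • f (ι p))

namespace IsOrthogonalSlice

variable {V : Set E₁} {ι : E₁ → E} {B : F →L[ℝ] F₁}

theorem contDiffAt (hι : IsOrthogonalSlice ε f U T V ι) (hV : IsOpen V) {p : E₁} (hp : p ∈ V) :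
    ContDiffAt ℝ ∞ ι p :=
  hι.smooth.contDiffAt (hV.mem_nhds hp)

theorem dual_fderiv (hι : IsOrthogonalSlice ε f U T V ι) {p : E₁} (hp : p ∈ V) (v : E₁) :
    metric ε f (ι p) (T (ι p)) (fderiv ℝ ι p v) = 0 :=
  (hι.mem_range_iff p hp _).1 ⟨v, rfl⟩

theorem fderiv_comp (hι : IsOrthogonalSlice ε f U T V ι) (hV : IsOpen V) {p : E₁} (hp : p ∈ V)
    {G : Type*} [NormedAddCommGroup G] [NormedSpace ℝ G] {k : E → G}
    (hk : DifferentiableAt ℝ k (ι p)) (z : E₁) :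
    DifferentiableAt ℝ (fun q => k (ι q)) p ∧
      fderiv ℝ (fun q => k (ι q)) p z = fderiv ℝ k (ι p) (fderiv ℝ ι p z) := by
  have h := hk.hasFDerivAt.comp p (differentiableAt_of_infty (hι.contDiffAt hV hp)).hasFDerivAt
  refine ⟨h.differentiableAt, ?_⟩
  rw [show (fun q => k (ι q)) = k ∘ ι from rfl, h.fderiv]
  rfl

/-- The slice is totally geodesic. -/
theorem exists_fderiv_eq (hι : IsOrthogonalSlice ε f U T V ι) (hV : IsOpen V)
    (hT : IsPrincipalField ε f U T (fun _ => a) (fun _ => b))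
    (hf : IsConvexCentroaffineOn ε f U) (hU : IsOpen U)
    (hK : ∀ x ∈ U, ∀ z v w, covDerivDiffTensor ε f x z v w = 0) {p : E₁} (hp : p ∈ V) (v w : E₁) :
    ∃ Z, fderiv ℝ ι p Z = leviCivitaL ε f (ι p) (fderiv ℝ ι p v) (fderiv ℝ ι p w)
      + fderiv ℝ (fderiv ℝ ι) p v w := by
  refine (hι.mem_range_iff p hp _).2 ?_
  have hx := hι.mapsTo p hp
  have h1 : (fun q => metric ε f (ι q) (T (ι q)) (fderiv ℝ ι q w)) =ᶠ[nhds p] fun _ => 0 := by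
    filter_upwards [hV.mem_nhds hp] with q hq using hι.dual_fderiv hq w
  have h2 := congrArg (fun L : E₁ →L[ℝ] ℝ => L v) h1.fderiv_eq
  have d1 := differentiableAt_of_infty (contDiffAt_fderiv_infty (hι.contDiffAt hV hp))
  have d2 : DifferentiableAt ℝ (fun q => fderiv ℝ ι q w) p := by fun_prop
  obtain ⟨d3, e3⟩ := hι.fderiv_comp hV hp (hT.differentiableAt_dual hf hU hx) v
  simp only [fderiv_clm_apply_apply d3 d2, e3, hT.fderiv_dual hf hU hx (hK _ hx),
    fderiv_clm_apply_apply d1 (differentiableAt_const w), fderiv_const_apply, zero_apply,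
    map_zero, add_zero] at h2
  rw [map_add, h2]

/-- The slice is totally geodesic, so the `T` component comes only from `K(v, w)`, and equals `b
h(v, w)`. -/
theorem exists_inducedConn (hι : IsOrthogonalSlice ε f U T V ι) (hV : IsOpen V)
    (hT : IsPrincipalField ε f U T (fun _ => a) (fun _ => b))
    (hf : IsConvexCentroaffineOn ε f U) (hU : IsOpen U)
    (hK : ∀ x ∈ U, ∀ z v w, covDerivDiffTensor ε f x z v w = 0) {p : E₁} (hp : p ∈ V) (v w : E₁) :
    ∃ Z, fderiv ℝ ι p Z = inducedConn f (ι p) (fderiv ℝ ι p v) (fderiv ℝ ι p w)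
      + fderiv ℝ (fderiv ℝ ι) p v w
      - (b * metric ε f (ι p) (fderiv ℝ ι p v) (fderiv ℝ ι p w)) • T (ι p) := by
  refine (hι.mem_range_iff p hp _).2 ?_
  have hx := hι.mapsTo p hp
  obtain ⟨Z, hZ⟩ := hι.exists_fderiv_eq hV hT hf hU hK hp v w
  have h1 := hι.dual_fderiv hp Z
  rw [hZ, map_add] at h1
  rw [inducedConn_eq ε, map_sub, map_smul, map_add, map_add, hT.unit _ hx,
    hT.dual_diffTensorL hf hU hx, hι.dual_fderiv hp]
  simp only [smul_eq_mul]
  linarith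

theorem contDiffOn_projection (hι : IsOrthogonalSlice ε f U T V ι) (hV : IsOpen V)
    (hf : IsConvexCentroaffineOn ε f U) (hU : IsOpen U) (B : F →L[ℝ] F₁) :
    ContDiffOn ℝ ∞ (fun q => B (f (ι q))) V := fun p hp =>
  (B.contDiff.contDiffAt.comp p ((hf.contDiffAt hU (hι.mapsTo p hp)).comp p
    (hι.contDiffAt hV hp))).contDiffWithinAt

theorem fderiv_projection (hι : IsOrthogonalSlice ε f U T V ι) (hV : IsOpen V)
    (hf : IsConvexCentroaffineOn ε f U) (hU : IsOpen U) (B : F →L[ℝ] F₁) {p : E₁} (hp : p ∈ V)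
    (v : E₁) : fderiv ℝ (fun q => B (f (ι q))) p v = B (fderiv ℝ f (ι p) (fderiv ℝ ι p v)) := by
  have hx := hι.mapsTo p hp
  have hd := differentiableAt_of_infty (hf.contDiffAt hU hx)
  rw [(hι.fderiv_comp hV hp (k := fun x => B (f x)) (B.differentiableAt.comp _ hd) v).2,
    show (fun x => B (f x)) = B ∘ f from rfl, (B.hasFDerivAt.comp _ hd.hasFDerivAt).fderiv]
  rfl

theorem fderiv_fderiv_projection (hι : IsOrthogonalSlice ε f U T V ι) (hV : IsOpen V)
    (hf : IsConvexCentroaffineOn ε f U) (hU : IsOpen U) (B : F →L[ℝ] F₁) {p : E₁} (hp : p ∈ V)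
    (v w : E₁) : fderiv ℝ (fderiv ℝ (fun q => B (f (ι q)))) p v w
      = B (fderiv ℝ (fderiv ℝ f) (ι p) (fderiv ℝ ι p v) (fderiv ℝ ι p w)
        + fderiv ℝ f (ι p) (fderiv ℝ (fderiv ℝ ι) p v w)) := by
  have hx := hι.mapsTo p hp
  have hc := (hι.contDiffOn_projection hV hf hU B).contDiffAt (hV.mem_nhds hp)
  have d0 := differentiableAt_of_infty (contDiffAt_fderiv_infty hc)
  have d1 := differentiableAt_of_infty (contDiffAt_fderiv_infty (hι.contDiffAt hV hp))
  have d2 : DifferentiableAt ℝ (fun q => fderiv ℝ ι q w) p := by fun_prop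
  obtain ⟨d3, e3⟩ := hι.fderiv_comp hV hp
    (differentiableAt_of_infty (contDiffAt_fderiv_infty (hf.contDiffAt hU hx))) v
  have h1 : (fun q => fderiv ℝ (fun q => B (f (ι q))) q w) =ᶠ[nhds p]
      fun q => B (fderiv ℝ f (ι q) (fderiv ℝ ι q w)) := by
    filter_upwards [hV.mem_nhds hp] with q hq using hι.fderiv_projection hV hf hU B hq w
  have h2 := congrArg (fun L : E₁ →L[ℝ] F₁ => L v) h1.fderiv_eq
  simp only [fderiv_clm_apply_apply d0 (differentiableAt_const w),
    fderiv_clm_apply_apply (differentiableAt_const B) (d3.clm_apply d2),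
    fderiv_clm_apply_apply d3 d2, e3, fderiv_clm_apply_apply d1 (differentiableAt_const w),
    fderiv_const_apply, zero_apply, map_zero, add_zero, zero_add] at h2
  exact h2

/-- The kernel line of `B` meets the span of the slice tangents and `f` only in zero, since its
generator has `T` component one. -/
theorem frame_projection_bijective (hι : IsOrthogonalSlice ε f U T V ι) (hV : IsOpen V)
    (hT : IsPrincipalField ε f U T (fun _ => a) (fun _ => b))
    (hf : IsConvexCentroaffineOn ε f U) (hU : IsOpen U) (hB : IsSliceProjection f T b V ι B)
    (hdim : Module.finrank ℝ F₁ = Module.finrank ℝ E₁ + 1) {p : E₁} (hp : p ∈ V) :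
    Function.Bijective (frame (fun q => B (f (ι q))) p) := by
  have hx := hι.mapsTo p hp
  have hinj : Function.Injective (frame (fun q => B (f (ι q))) p).toLinearMap := by
    rw [injective_iff_map_eq_zero]
    rintro ⟨v, t⟩ h
    have h' : frame (fun q => B (f (ι q))) p (v, t) = 0 := h
    rw [frame_apply, hι.fderiv_projection hV hf hU B hp, ← map_smul, ← map_add] at h'
    obtain ⟨s, hs⟩ := hB.ker p hp _ h'
    have h1 : frame f (ι p) (fderiv ℝ ι p v - s • T (ι p), t + s * b) = 0 := by
      rw [frame_apply, map_sub, map_smul]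
      linear_combination (norm := module) hs
    have h2 := (hf.frame_bijective hx).1 (h1.trans (map_zero _).symm)
    have h3 : fderiv ℝ ι p v = s • T (ι p) := sub_eq_zero.1 (congrArg Prod.fst h2)
    have h4 : t + s * b = 0 := congrArg Prod.snd h2
    have h5 := hι.dual_fderiv hp v
    rw [h3, map_smul, hT.unit _ hx, smul_eq_mul, mul_one] at h5
    rw [h5, zero_smul] at h3
    have h6 : v = 0 := hι.immersion p hp (h3.trans (map_zero _).symm)
    have h7 : t = 0 := by simpa [h5] using h4
    simp [h6, h7]
  exact ⟨hinj, (LinearMap.injective_iff_surjective_of_finrank_eq_finrank (by simp [hdim])).1 hinj⟩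

/-- The normal term `b h(v, w) T` is sent by `B ∘ f_*` to `b² h(v, w) B f`, which turns `ε` into `ε
- b²`. -/
theorem gauss_projection (hι : IsOrthogonalSlice ε f U T V ι) (hV : IsOpen V)
    (hf : IsConvexCentroaffineOn ε f U) (hU : IsOpen U) (hB : IsSliceProjection f T b V ι B)
    {p : E₁} (hp : p ∈ V) {v w Z : E₁}
    (hZ : fderiv ℝ ι p Z = inducedConn f (ι p) (fderiv ℝ ι p v) (fderiv ℝ ι p w)
      + fderiv ℝ (fderiv ℝ ι) p v w
      - (b * metric ε f (ι p) (fderiv ℝ ι p v) (fderiv ℝ ι p w)) • T (ι p)) :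
    fderiv ℝ (fderiv ℝ (fun q => B (f (ι q)))) p v w
      = fderiv ℝ (fun q => B (f (ι q))) p Z
        - ((ε - b ^ 2) * metric ε f (ι p) (fderiv ℝ ι p v) (fderiv ℝ ι p w)) • B (f (ι p)) := by
  have hx := hι.mapsTo p hp
  rw [hι.fderiv_fderiv_projection hV hf hU B hp, hι.fderiv_projection hV hf hU B hp, hZ,
    hf.gauss hx]
  simp only [map_add, map_sub, map_smul, hB.tangent p hp]
  module

/-- Geometric data of the projected slice. -/
theorem metric_projection (hι : IsOrthogonalSlice ε f U T V ι) (hV : IsOpen V)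
    (hT : IsPrincipalField ε f U T (fun _ => a) (fun _ => b))
    (hf : IsConvexCentroaffineOn ε f U) (hU : IsOpen U)
    (hK : ∀ x ∈ U, ∀ z v w, covDerivDiffTensor ε f x z v w = 0)
    (hB : IsSliceProjection f T b V ι B)
    (hdim : Module.finrank ℝ F₁ = Module.finrank ℝ E₁ + 1) {ε₁ κ : ℝ} (hε₁ : ε₁ = 1 ∨ ε₁ = -1)
    (hκ : ε₁ * κ = ε - b ^ 2) {p : E₁} (hp : p ∈ V) (v w : E₁) :
    metric ε₁ (fun q => B (f (ι q))) p v w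
        = κ * metric ε f (ι p) (fderiv ℝ ι p v) (fderiv ℝ ι p w) ∧
      fderiv ℝ ι p (inducedConn (fun q => B (f (ι q))) p v w)
        = inducedConn f (ι p) (fderiv ℝ ι p v) (fderiv ℝ ι p w) + fderiv ℝ (fderiv ℝ ι) p v w
          - (b * metric ε f (ι p) (fderiv ℝ ι p v) (fderiv ℝ ι p w)) • T (ι p) := by
  obtain ⟨Z, hZ⟩ := hι.exists_inducedConn hV hT hf hU hK hp v w
  have h1 := hι.gauss_projection hV hf hU hB hp hZ
  rw [← hκ, mul_assoc] at h1
  obtain ⟨h2, h3⟩ := metric_eq_of_gauss hε₁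
    (hι.frame_projection_bijective hV hT hf hU hB hdim hp) h1
  exact ⟨h2, h3 ▸ hZ⟩

theorem isConvexCentroaffineOn (hι : IsOrthogonalSlice ε f U T V ι) (hV : IsOpen V)
    (hT : IsPrincipalField ε f U T (fun _ => a) (fun _ => b))
    (hf : IsConvexCentroaffineOn ε f U) (hU : IsOpen U)
    (hK : ∀ x ∈ U, ∀ z v w, covDerivDiffTensor ε f x z v w = 0)
    (hB : IsSliceProjection f T b V ι B)
    (hdim : Module.finrank ℝ F₁ = Module.finrank ℝ E₁ + 1) {ε₁ κ : ℝ} (hε₁ : ε₁ = 1 ∨ ε₁ = -1)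
    (hκ : ε₁ * κ = ε - b ^ 2) (hκ0 : 0 < κ) :
    IsConvexCentroaffineOn ε₁ (fun q => B (f (ι q))) V := by
  have hb := fun p hp => hι.frame_projection_bijective hV hT hf hU hB hdim (p := p) hp
  refine ⟨hε₁, hι.contDiffOn_projection hV hf hU B, fun p hp v w h => ?_, fun p hp h => ?_,
    fun p hp => isCompl_of_bijective_frame (hb p hp), fun p hp v hv => ?_⟩
  · have : ((v, 0) : E₁ × ℝ) = (w, 0) := (hb p hp).1 (by simp only [frame_apply, h])
    exact congrArg Prod.fst this
  · have : ((0, 1) : E₁ × ℝ) = 0 := (hb p hp).1 (by simpa [frame_apply] using h)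
    exact one_ne_zero (congrArg Prod.snd this)
  · rw [(hι.metric_projection hV hT hf hU hK hB hdim hε₁ hκ hp v v).1]
    exact mul_pos hκ0 (hf.posDef _ (hι.mapsTo p hp) _ fun h =>
      hv (hι.immersion p hp (h.trans (map_zero _).symm)))

/-- A constant factor does not change the Levi-Civita connection, and that of a totally geodesic
slice is the ambient one. -/
theorem leviCivita_projection (hι : IsOrthogonalSlice ε f U T V ι) (hV : IsOpen V)
    (hT : IsPrincipalField ε f U T (fun _ => a) (fun _ => b))
    (hf : IsConvexCentroaffineOn ε f U) (hU : IsOpen U)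
    (hK : ∀ x ∈ U, ∀ z v w, covDerivDiffTensor ε f x z v w = 0)
    (hB : IsSliceProjection f T b V ι B)
    (hdim : Module.finrank ℝ F₁ = Module.finrank ℝ E₁ + 1) {ε₁ κ : ℝ} (hε₁ : ε₁ = 1 ∨ ε₁ = -1)
    (hκ : ε₁ * κ = ε - b ^ 2) (hκ0 : 0 < κ) {p : E₁} (hp : p ∈ V) (v w : E₁) :
    fderiv ℝ ι p (leviCivitaL ε₁ (fun q => B (f (ι q))) p v w)
      = leviCivitaL ε f (ι p) (fderiv ℝ ι p v) (fderiv ℝ ι p w)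
        + fderiv ℝ (fderiv ℝ ι) p v w := by
  have hx := hι.mapsTo p hp
  have hf₁ := hι.isConvexCentroaffineOn hV hT hf hU hK hB hdim hε₁ hκ hκ0
  have hm := fun q hq v w => (hι.metric_projection hV hT hf hU hK hB hdim hε₁ hκ (p := q) hq v w).1
  choose Γ hΓ using hι.exists_fderiv_eq hV hT hf hU hK hp
  rw [hf₁.leviCivitaL_unique hV hp (Γ := Γ) ?_ ?_, hΓ]
  · intro v w
    refine hι.immersion p hp ?_
    rw [hΓ, hΓ, hf.leviCivitaL_comm hU hx, fderiv_fderiv_comm (hι.contDiffAt hV hp) v w]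
  · intro z v w
    have h1 : (fun q => metric ε₁ (fun q => B (f (ι q))) q v w) =ᶠ[nhds p]
        fun q => κ * metric ε f (ι q) (fderiv ℝ ι q v) (fderiv ℝ ι q w) := by
      filter_upwards [hV.mem_nhds hp] with q hq using hm q hq v w
    have d0 := differentiableAt_of_infty (hf₁.contDiffAt_metric hV hp)
    have d1 := differentiableAt_of_infty (contDiffAt_fderiv_infty (hι.contDiffAt hV hp))
    have d2 : ∀ w, DifferentiableAt ℝ (fun q => fderiv ℝ ι q w) p := fun w => by fun_prop
    obtain ⟨d3, e3⟩ := hι.fderiv_comp hV hp (differentiableAt_of_infty (hf.contDiffAt_metric hU hx)) z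
    have d4 : DifferentiableAt ℝ (fun q => metric ε f (ι q) (fderiv ℝ ι q v) (fderiv ℝ ι q w)) p :=
      (d3.clm_apply (d2 v)).clm_apply (d2 w)
    have h2 := congrArg (fun L : E₁ →L[ℝ] ℝ => L z) h1.fderiv_eq
    simp only [fderiv_bilin_const d0, fderiv_const_mul d4, smul_apply, smul_eq_mul,
      fderiv_bilin_apply d3 (d2 v) (d2 w), e3, hf.fderiv_metric hU hx,
      fderiv_clm_apply_apply d1 (differentiableAt_const _),
      fderiv_const_apply, zero_apply, map_zero, add_zero] at h2
    rw [h2, hm p hp, hm p hp, hΓ, hΓ]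
    simp only [map_add, add_apply]
    ring

/-- The `T` correction in the projected connection disappears when paired with slice vectors. -/
theorem cubicForm_projection (hι : IsOrthogonalSlice ε f U T V ι) (hV : IsOpen V)
    (hT : IsPrincipalField ε f U T (fun _ => a) (fun _ => b))
    (hf : IsConvexCentroaffineOn ε f U) (hU : IsOpen U)
    (hK : ∀ x ∈ U, ∀ z v w, covDerivDiffTensor ε f x z v w = 0)
    (hB : IsSliceProjection f T b V ι B)
    (hdim : Module.finrank ℝ F₁ = Module.finrank ℝ E₁ + 1) {ε₁ κ : ℝ} (hε₁ : ε₁ = 1 ∨ ε₁ = -1)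
    (hκ : ε₁ * κ = ε - b ^ 2) (hκ0 : 0 < κ) {p : E₁} (hp : p ∈ V) (u v w : E₁) :
    cubicForm ε₁ (fun q => B (f (ι q))) p u v w
      = (-2 * κ) * metric ε f (ι p)
        (diffTensorL ε f (ι p) (fderiv ℝ ι p u) (fderiv ℝ ι p v)) (fderiv ℝ ι p w) := by
  have hf₁ := hι.isConvexCentroaffineOn hV hT hf hU hK hB hdim hε₁ hκ hκ0
  rw [hf₁.cubicForm_eq hV hp,
    (hι.metric_projection hV hT hf hU hK hB hdim hε₁ hκ hp _ _).1, diffTensorL, sub_apply,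
    sub_apply, map_sub, (hι.metric_projection hV hT hf hU hK hB hdim hε₁ hκ hp u v).2,
    hι.leviCivita_projection hV hT hf hU hK hB hdim hε₁ hκ hκ0 hp, inducedConn_eq ε]
  simp only [map_sub, map_add, map_smul, sub_apply, add_apply, smul_apply, hι.dual_fderiv hp,
    smul_zero]
  ring

/-- Pull back the parallel tensor `h(K(·,·),·)`: the derivatives of `h`, of `K` and of `ι_*` cancel
against the projected Levi-Civita terms. -/
theorem covDerivCubicForm_projection (hι : IsOrthogonalSlice ε f U T V ι) (hV : IsOpen V)
    (hT : IsPrincipalField ε f U T (fun _ => a) (fun _ => b))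
    (hf : IsConvexCentroaffineOn ε f U) (hU : IsOpen U)
    (hK : ∀ x ∈ U, ∀ z v w, covDerivDiffTensor ε f x z v w = 0)
    (hB : IsSliceProjection f T b V ι B)
    (hdim : Module.finrank ℝ F₁ = Module.finrank ℝ E₁ + 1) {ε₁ κ : ℝ} (hε₁ : ε₁ = 1 ∨ ε₁ = -1)
    (hκ : ε₁ * κ = ε - b ^ 2) (hκ0 : 0 < κ) {p : E₁} (hp : p ∈ V) (z u v w : E₁) :
    covDerivCubicForm ε₁ (fun q => B (f (ι q))) p z u v w = 0 := by
  have hx := hι.mapsTo p hp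
  have hC := fun q hq u v w =>
    hι.cubicForm_projection hV hT hf hU hK hB hdim hε₁ hκ hκ0 (p := q) hq u v w
  have h1 : (fun q => cubicForm ε₁ (fun q => B (f (ι q))) q u v w) =ᶠ[nhds p]
      fun q => (-2 * κ) * metric ε f (ι q)
        (diffTensorL ε f (ι q) (fderiv ℝ ι q u) (fderiv ℝ ι q v)) (fderiv ℝ ι q w) := by
    filter_upwards [hV.mem_nhds hp] with q hq using hC q hq u v w
  have d1 := differentiableAt_of_infty (contDiffAt_fderiv_infty (hι.contDiffAt hV hp))
  have d2 : ∀ w, DifferentiableAt ℝ (fun q => fderiv ℝ ι q w) p := fun w => by fun_prop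
  obtain ⟨d3, e3⟩ := hι.fderiv_comp hV hp (differentiableAt_of_infty (hf.contDiffAt_metric hU hx)) z
  obtain ⟨d4, e4⟩ := hι.fderiv_comp hV hp
    (differentiableAt_of_infty (hf.contDiffAt_diffTensorL hU hx)) z
  have d5 : DifferentiableAt ℝ
      (fun q => diffTensorL ε f (ι q) (fderiv ℝ ι q u) (fderiv ℝ ι q v)) p :=
    (d4.clm_apply (d2 u)).clm_apply (d2 v)
  have d6 : DifferentiableAt ℝ (fun q => metric ε f (ι q)
      (diffTensorL ε f (ι q) (fderiv ℝ ι q u) (fderiv ℝ ι q v)) (fderiv ℝ ι q w)) p :=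
    (d3.clm_apply d5).clm_apply (d2 w)
  rw [covDerivCubicForm, h1.fderiv_eq, fderiv_const_mul d6]
  simp only [hC p hp, ← leviCivitaL_apply,
    hι.leviCivita_projection hV hT hf hU hK hB hdim hε₁ hκ hκ0 hp, smul_apply, smul_eq_mul,
    fderiv_bilin_apply d3 d5 (d2 w), fderiv_bilin_apply d4 (d2 u) (d2 v), e3, e4,
    hf.fderiv_metric hU hx, hf.fderiv_diffTensorL hU hx (hK _ hx),
    fderiv_clm_apply_apply d1 (differentiableAt_const _), fderiv_const_apply, zero_apply,
    map_zero, add_zero, map_add, map_sub, add_apply, sub_apply]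
  ring

end IsOrthogonalSlice

end Slice

/-! ### Splitting a vector space along a functional and a vector. -/

section LinearSplitting

variable {E E₁ : Type*} [NormedAddCommGroup E] [NormedSpace ℝ E] [FiniteDimensional ℝ E]
  [NormedAddCommGroup E₁] [NormedSpace ℝ E₁] [FiniteDimensional ℝ E₁]

theorem exists_equiv_prod (hdim : Module.finrank ℝ E = Module.finrank ℝ E₁ + 1)
    (η : E →L[ℝ] ℝ) {t : E} (ht : η t = 1) :
    ∃ L : E ≃L[ℝ] E₁ × ℝ, (∀ v, (L v).2 = η v) ∧ L t = (0, 1) := by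
  have hr : Function.RightInverse (ContinuousLinearMap.toSpanSingleton ℝ t) η := fun s => by
    simp [ht]
  let e := ContinuousLinearEquiv.equivOfRightInverse η (ContinuousLinearMap.toSpanSingleton ℝ t) hr
  have hk : Module.finrank ℝ η.ker = Module.finrank ℝ E₁ := by
    have h := e.toLinearEquiv.finrank_eq
    rw [Module.finrank_prod, Module.finrank_self] at h
    omega
  let j : η.ker ≃L[ℝ] E₁ := ContinuousLinearEquiv.ofFinrankEq hk
  refine ⟨e.trans ((ContinuousLinearEquiv.prodComm ℝ ℝ η.ker).trans
    (j.prodCongr (ContinuousLinearEquiv.refl ℝ ℝ))), fun v => ?_, ?_⟩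
  · rfl
  · refine Prod.ext ?_ ht
    have h0 : (e t).2 = 0 := by
      ext
      simp [e, ht]
    change j (e t).2 = 0
    rw [h0, map_zero]

end LinearSplitting

/-! ### Product-shaped local coordinates. -/

section InverseFunction

variable {E E₁ : Type*} [NormedAddCommGroup E] [NormedSpace ℝ E] [CompleteSpace E]
  [NormedAddCommGroup E₁] [NormedSpace ℝ E₁]

/-- The inverse function theorem, with a box as the target. -/
theorem exists_openPartialHomeomorph_box {Φ₀ : E → ℝ × E₁} {W : Set E} (hW : IsOpen W)
    (hΦ₀ : ContDiffOn ℝ ∞ Φ₀ W) {x₀ : E} (hx₀ : x₀ ∈ W) (hinv : (fderiv ℝ Φ₀ x₀).IsInvertible) :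
    ∃ (Φ : OpenPartialHomeomorph E (ℝ × E₁)) (r : ℝ), (∀ x, Φ x = Φ₀ x) ∧ x₀ ∈ Φ.source ∧
      Φ.source ⊆ W ∧ 0 < r ∧ Φ.target = Set.Ioo ((Φ₀ x₀).1 - r) ((Φ₀ x₀).1 + r)
        ×ˢ Metric.ball (Φ₀ x₀).2 r ∧
      ContDiffOn ℝ ∞ Φ.symm Φ.target ∧ ∀ x ∈ Φ.source, (fderiv ℝ Φ₀ x).IsInvertible := by
  have hc := fun x hx => hΦ₀.contDiffAt (hW.mem_nhds (x := x) hx)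
  obtain ⟨e, he⟩ := hinv
  have hd : HasFDerivAt Φ₀ (e : E →L[ℝ] ℝ × E₁) x₀ :=
    he ▸ (differentiableAt_of_infty (hc x₀ hx₀)).hasFDerivAt
  let ρ := (hc x₀ hx₀).toOpenPartialHomeomorph Φ₀ hd (by simp)
  have hρ : ∀ x, ρ x = Φ₀ x := fun x => rfl
  have hρs : x₀ ∈ ρ.source := (hc x₀ hx₀).mem_toOpenPartialHomeomorph_source hd (by simp)
  have hS : {x | x ∈ W ∧ (fderiv ℝ Φ₀ x).IsInvertible} ∈ nhds x₀ := by
    have hcont := (contDiffAt_fderiv_infty (hc x₀ hx₀)).continuousAt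
    have hopen : Set.range ((↑) : (E ≃L[ℝ] ℝ × E₁) → E →L[ℝ] ℝ × E₁) ∈ nhds (fderiv ℝ Φ₀ x₀) :=
      ContinuousLinearEquiv.isOpen.mem_nhds ⟨e, he⟩
    filter_upwards [hW.mem_nhds hx₀, hcont hopen] with x h1 h2
    exact ⟨h1, h2⟩
  have hρt : ρ x₀ ∈ ρ.target := ρ.map_source hρs
  have hN : ρ.target ∩ ρ.symm ⁻¹' {x | x ∈ W ∧ (fderiv ℝ Φ₀ x).IsInvertible} ∈ nhds (ρ x₀) := by
    refine Filter.inter_mem (ρ.open_target.mem_nhds hρt) ((ρ.continuousAt_symm hρt) ?_)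
    rwa [ρ.left_inv hρs]
  obtain ⟨r, hr, hball⟩ := Metric.mem_nhds_iff.1 hN
  have htarget : ρ.target ∩ Metric.ball (ρ x₀) r = Metric.ball (ρ x₀) r :=
    Set.inter_eq_right.2 fun y hy => (hball hy).1
  -- Restricting the inverse prescribes the target; a ball for the sup norm of the product is a box.
  let Φ := (ρ.symm.restrOpen (Metric.ball (ρ x₀) r) Metric.isOpen_ball).symm
  have hΦt : Φ.target = Metric.ball (ρ x₀) r := htarget
  have hΦsymm : ∀ y, Φ.symm y = ρ.symm y := fun y => rfl
  have hΦ : ∀ x, Φ x = Φ₀ x := fun x => rfl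
  have hsrc : ∀ x ∈ Φ.source, x ∈ W ∧ (fderiv ℝ Φ₀ x).IsInvertible := by
    intro x hx
    have h1 := (hball (hΦt ▸ Φ.map_source hx)).2
    rw [Set.mem_preimage, ← hΦsymm, Φ.left_inv hx] at h1
    exact h1
  refine ⟨Φ, r, hΦ, ?_, fun x hx => (hsrc x hx).1, hr, ?_, ?_, fun x hx => (hsrc x hx).2⟩
  · have h1 : Φ.symm (ρ x₀) ∈ Φ.source :=
      Φ.map_target (hΦt ▸ Metric.mem_ball_self hr)
    rwa [hΦsymm, ρ.left_inv hρs] at h1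
  · rw [hΦt, ← Real.ball_eq_Ioo, ball_prod_same]
    rfl
  · intro y hy
    obtain ⟨h1, e', he'⟩ := hsrc _ (Φ.map_target hy)
    refine (Φ.contDiffAt_symm (f₀' := e') hy ?_ (hc _ h1)).contDiffWithinAt
    rw [he']
    exact (differentiableAt_of_infty (hc _ h1)).hasFDerivAt

end InverseFunction

/-! ### The Calabi decomposition in coordinates. -/

section LocalDecomposition

variable {E F E₁ F₁ : Type*} [NormedAddCommGroup E] [NormedSpace ℝ E] [FiniteDimensional ℝ E]
  [NormedAddCommGroup F] [NormedSpace ℝ F] [FiniteDimensional ℝ F]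
  [NormedAddCommGroup E₁] [NormedSpace ℝ E₁] [FiniteDimensional ℝ E₁]
  [NormedAddCommGroup F₁] [NormedSpace ℝ F₁] [FiniteDimensional ℝ F₁]
  {ε : ℝ} {f : E → F} {U : Set E} {T : E → E}

theorem IsPointSplitting.apply_fderiv {μ b : ℝ} {W : Set E} {g : E → ℝ} {w : F} {β : F →L[ℝ] ℝ}
    (hs : IsPointSplitting ε f T μ b W g w β) (hW : IsOpen W) {x : E} (hx : x ∈ W)
    (hf : DifferentiableAt ℝ f x) (v : E) : β (fderiv ℝ f x v) = fderiv ℝ g x v := by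
  have h1 : (β ∘ f) =ᶠ[nhds x] g := by
    filter_upwards [hW.mem_nhds hx] with y hy using hs.apply_pos y hy
  have h2 := congrArg (fun L : E →L[ℝ] ℝ => L v) h1.fderiv_eq
  rw [(β.hasFDerivAt.comp x hf.hasFDerivAt).fderiv] at h2
  exact h2

/-- The factor `f₁ = e^{-u} B f` is constant along `T`. -/
theorem IsPointSplitting.fderiv_factor {μ b : ℝ} {W : Set E} {g : E → ℝ} {w : F} {β : F →L[ℝ] ℝ}
    (hs : IsPointSplitting ε f T μ b W g w β) (hW : IsOpen W) (hf : IsConvexCentroaffineOn ε f W)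
    (hμ : μ ≠ 0) (B : F →L[ℝ] F₁) {x : E} (hx : x ∈ W) :
    ContDiffAt ℝ ∞ (fun y => b / μ * Real.log (g y)) x ∧
    (∀ v, fderiv ℝ (fun y => b / μ * Real.log (g y)) x v = b * metric ε f x (T x) v) ∧
    ContDiffAt ℝ ∞ (fun y => Real.exp (-(b / μ * Real.log (g y))) • B (f y)) x ∧
    ∀ v, fderiv ℝ (fun y => Real.exp (-(b / μ * Real.log (g y))) • B (f y)) x v
      = Real.exp (-(b / μ * Real.log (g x))) •
        (B (fderiv ℝ f x v) - (b * metric ε f x (T x) v) • B (f x)) := by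
  have hg := hs.smooth.contDiffAt (hW.mem_nhds hx)
  have hpos := hs.pos x hx
  set u : E → ℝ := fun y => b / μ * Real.log (g y) with hu
  have huc : ContDiffAt ℝ ∞ u x := contDiffAt_const.mul (hg.log hpos.ne')
  have hdu : ∀ v, fderiv ℝ u x v = b * metric ε f x (T x) v := by
    intro v
    have h1 := (((differentiableAt_of_infty hg).hasFDerivAt.log hpos.ne').const_mul (b / μ)).fderiv
    rw [hu, h1, smul_apply, smul_apply, hs.fderiv_eq x hx, smul_eq_mul, smul_eq_mul]
    field_simp
  have hBf : ContDiffAt ℝ ∞ (fun y => B (f y)) x :=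
    B.contDiff.contDiffAt.comp x (hf.contDiffAt hW hx)
  have hdB : HasFDerivAt (fun y => B (f y)) (B.comp (fderiv ℝ f x)) x :=
    B.hasFDerivAt.comp x (differentiableAt_of_infty (hf.contDiffAt hW hx)).hasFDerivAt
  refine ⟨huc, hdu, huc.neg.exp.smul hBf, fun v => ?_⟩
  have h1 := ((differentiableAt_of_infty huc).hasFDerivAt.neg.exp.smul hdB).fderiv
  have h2 := congrArg (fun L : E →L[ℝ] F₁ => L v) h1
  simp only [add_apply, smul_apply, ContinuousLinearMap.smulRight_apply, neg_apply, hdu,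
    ContinuousLinearMap.comp_apply, Pi.neg_apply, smul_eq_mul] at h2
  refine Eq.trans h2 ?_
  module

theorem IsPrincipalField.exists_local_decomposition {a b : ℝ}
    (hT : IsPrincipalField ε f U T (fun _ => a) (fun _ => b))
    (hf : IsConvexCentroaffineOn ε f U) (hU : IsOpen U) (hε : ε = b * (a - b))
    (hK : ∀ x ∈ U, ∀ z v w, covDerivDiffTensor ε f x z v w = 0)
    (hE : Module.finrank ℝ E = Module.finrank ℝ E₁ + 1)
    (hF : Module.finrank ℝ F = Module.finrank ℝ F₁ + 1)
    (hEF : Module.finrank ℝ F₁ = Module.finrank ℝ E₁ + 1) {x₀ : E} (hx₀ : x₀ ∈ U) :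
    ∃ (c ε₁ r s : ℝ) (V : Set E₁) (ψ₁ : E₁ → F₁) (A : F ≃L[ℝ] F₁ × ℝ)
      (Φ : OpenPartialHomeomorph E (ℝ × E₁)),
      c ≠ 0 ∧ c ≠ -1 ∧ IsOpen V ∧ IsConvexCentroaffineOn ε₁ ψ₁ V ∧
      (∀ x ∈ V, ∀ z u v w, covDerivCubicForm ε₁ ψ₁ x z u v w = 0) ∧
      x₀ ∈ Φ.source ∧ Φ.source ⊆ U ∧ Φ.target = Set.Ioo r s ×ˢ V ∧
      ContDiffOn ℝ ∞ Φ Φ.source ∧ ContDiffOn ℝ ∞ Φ.symm Φ.target ∧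
      ∀ x ∈ Φ.source, A (f x) = calabiPoint c ψ₁ (Φ x) := by
  have hε0 : ε ≠ 0 := by rintro rfl; simpa using hf.mul_self_eps
  set μ := a - b with hμdef
  have hb : b ≠ 0 := fun h => hε0 (by rw [hε, h, zero_mul])
  have hμ : μ ≠ 0 := fun h => hε0 (by rw [hε, h, mul_zero])
  have hμb : μ - b ≠ 0 := fun h => hT.ne x₀ hx₀ (by linarith)
  obtain ⟨W, g, w, β, hW, hx₀W, hWU, hg1, hs⟩ := hT.exists_isPointSplitting hf hU hε hK hx₀
  rw [← hμdef] at hs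
  have hfW := hf.mono hWU
  obtain ⟨A, hAβ, hAw⟩ := exists_equiv_prod (E₁ := F₁) hF β hs.apply_dir
  let B : F →L[ℝ] F₁ := (ContinuousLinearMap.fst ℝ F₁ ℝ).comp (A : F →L[ℝ] F₁ × ℝ)
  have hA : ∀ y, A y = (B y, β y) := fun y => Prod.ext rfl (hAβ y)
  have hBw : B w = 0 := congrArg Prod.fst hAw
  have hBker : ∀ y, B y = 0 → y = β y • w := by
    intro y hy
    apply A.injective
    rw [map_smul, hAw, hA, hy]
    simp
  have hfac := fun x hx => hs.fderiv_factor hW hfW hμ B (x := x) hx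
  set u : E → ℝ := fun y => b / μ * Real.log (g y) with hu
  set f₁ : E → F₁ := fun y => Real.exp (-u y) • B (f y) with hf₁
  have huc : ∀ x ∈ W, ContDiffAt ℝ ∞ u x := fun x hx => (hfac x hx).1
  have hdu : ∀ x ∈ W, ∀ v, fderiv ℝ u x v = b * metric ε f x (T x) v := fun x hx =>
    (hfac x hx).2.1
  have hf₁c : ∀ x ∈ W, ContDiffAt ℝ ∞ f₁ x := fun x hx => (hfac x hx).2.2.1
  have hdf₁ : ∀ x ∈ W, ∀ v, fderiv ℝ f₁ x v = Real.exp (-u x) •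
      (B (fderiv ℝ f x v) - (b * metric ε f x (T x) v) • B (f x)) := fun x hx => (hfac x hx).2.2.2
  have hBT : ∀ x ∈ W, B (fderiv ℝ f x (T x)) = b • B (f x) := fun x hx => by
    rw [hs.tangent x hx, map_add, map_smul, map_smul, hBw, smul_zero, add_zero]
  have hdf₁T : ∀ x ∈ W, fderiv ℝ f₁ x (T x) = 0 := fun x hx => by
    rw [hdf₁ x hx, hBT x hx, hT.unit x (hWU hx), mul_one, sub_self, smul_zero]
  have hu0 : u x₀ = 0 := by simp [hu, hg1]
  obtain ⟨L, hLη, -⟩ := exists_equiv_prod (E₁ := E₁) hE (metric ε f x₀ (T x₀)) (hT.unit x₀ hx₀)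
  -- `π` is chosen so that `π ∘ B ∘ f_*` at `x₀` gives linear coordinates on the orthogonal
  -- complement of `T`; thus `(u, π f₁)` is a chart there.
  let π : F₁ →L[ℝ] E₁ := (ContinuousLinearMap.fst ℝ E₁ ℝ).comp ((L : E →L[ℝ] E₁ × ℝ).comp
    ((ContinuousLinearMap.fst ℝ E ℝ).comp ((frame f x₀).inverse.comp
      ((A.symm : F₁ × ℝ →L[ℝ] F).comp (ContinuousLinearMap.inl ℝ F₁ ℝ)))))
  have hπ : ∀ v, metric ε f x₀ (T x₀) v = 0 → π (B (fderiv ℝ f x₀ v)) = (L v).1 := by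
    intro v hv
    have h1 : β (fderiv ℝ f x₀ v) = 0 := by
      rw [hs.apply_fderiv hW hx₀W (differentiableAt_of_infty (hf.contDiffAt hU hx₀)),
        hs.fderiv_eq x₀ hx₀W, hv, mul_zero]
    have h2 : A.symm (B (fderiv ℝ f x₀ v), 0) = frame f x₀ (v, 0) := by
      rw [← h1, ← hA, A.symm_apply_apply, frame_apply, h1, zero_smul, add_zero]
    change (L ((frame f x₀).inverse (A.symm (B (fderiv ℝ f x₀ v), 0))).1).1 = _
    rw [h2, (hf.frame_isInvertible hx₀).inverse_apply_self]
  let Φ₀ : E → ℝ × E₁ := fun x => (u x, π (f₁ x))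
  have hΦ₀c : ContDiffOn ℝ ∞ Φ₀ W := fun x hx =>
    ((huc x hx).prodMk (π.contDiff.contDiffAt.comp x (hf₁c x hx))).contDiffWithinAt
  have hdΦ₀ : ∀ x ∈ W, ∀ v, fderiv ℝ Φ₀ x v = (fderiv ℝ u x v, π (fderiv ℝ f₁ x v)) := by
    intro x hx v
    have h1 := ((differentiableAt_of_infty (huc x hx)).hasFDerivAt.prodMk
      (π.hasFDerivAt.comp x (differentiableAt_of_infty (hf₁c x hx)).hasFDerivAt)).fderiv
    exact congrArg (fun L : E →L[ℝ] ℝ × E₁ => L v) h1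
  have hinv : (fderiv ℝ Φ₀ x₀).IsInvertible := by
    have hinj : Function.Injective (fderiv ℝ Φ₀ x₀).toLinearMap := by
      rw [injective_iff_map_eq_zero]
      intro v hv
      have hv' : fderiv ℝ Φ₀ x₀ v = 0 := hv
      rw [hdΦ₀ x₀ hx₀W, hdu x₀ hx₀W, Prod.mk_eq_zero] at hv'
      have hη : metric ε f x₀ (T x₀) v = 0 := (mul_eq_zero.1 hv'.1).resolve_left hb
      have h2 := hv'.2
      rw [hdf₁ x₀ hx₀W, hη, hu0, neg_zero, Real.exp_zero, one_smul, mul_zero, zero_smul, sub_zero,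
        hπ v hη] at h2
      refine L.injective ?_
      rw [map_zero]
      exact Prod.ext h2 ((hLη v).trans hη)
    refine isInvertible_of_bijective ⟨hinj,
      (LinearMap.injective_iff_surjective_of_finrank_eq_finrank ?_).1 hinj⟩
    rw [Module.finrank_prod, Module.finrank_self, hE, add_comm]
  obtain ⟨Φ, r, hΦ, hxΦ, hΦW, hr, hΦt, hΦs, hΦinv⟩ :=
    exists_openPartialHomeomorph_box hW hΦ₀c hx₀W hinv
  have hΦ₀1 : (Φ₀ x₀).1 = 0 := hu0
  rw [hΦ₀1, zero_sub, zero_add] at hΦt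
  set V := Metric.ball (Φ₀ x₀).2 r with hV
  have hVo : IsOpen V := Metric.isOpen_ball
  have hsymmc : ∀ y ∈ Φ.target, ContDiffAt ℝ ∞ Φ.symm y := fun y hy =>
    hΦs.contDiffAt (Φ.open_target.mem_nhds hy)
  have hchain : ∀ y ∈ Φ.target, ∀ v, fderiv ℝ Φ₀ (Φ.symm y) (fderiv ℝ Φ.symm y v) = v := by
    intro y hy v
    have hx := hΦW (Φ.map_target hy)
    have h1 : (Φ₀ ∘ Φ.symm) =ᶠ[nhds y] id := by
      filter_upwards [Φ.open_target.mem_nhds hy] with q hq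
      rw [Function.comp_apply, ← hΦ, Φ.right_inv hq, id]
    have h2 := (((hΦ₀c.contDiffAt (hW.mem_nhds hx)).differentiableAt (by simp)).hasFDerivAt.comp y
      (differentiableAt_of_infty (hsymmc y hy)).hasFDerivAt).fderiv
    rw [h1.fderiv_eq, fderiv_id] at h2
    exact (congrArg (fun L : (ℝ × E₁) →L[ℝ] ℝ × E₁ => L v) h2).symm
  have hmem : ∀ t ∈ Set.Ioo (-r) r, ∀ p ∈ V, (t, p) ∈ Φ.target := fun t ht p hp => by
    rw [hΦt]; exact ⟨ht, hp⟩
  have h0mem : (0 : ℝ) ∈ Set.Ioo (-r) r := ⟨by linarith, hr⟩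
  -- The slice is the level set `u = 0`, equivalently `g = 1`; its tangent space is `ker η` because
  -- `du = b η`.
  let ι : E₁ → E := fun p => Φ.symm (0, p)
  have hιW : ∀ p ∈ V, ι p ∈ W := fun p hp => hΦW (Φ.map_target (hmem 0 h0mem p hp))
  have hιΦ : ∀ p ∈ V, Φ₀ (ι p) = (0, p) := fun p hp => by
    rw [← hΦ]; exact Φ.right_inv (hmem 0 h0mem p hp)
  have hιu : ∀ p ∈ V, u (ι p) = 0 := fun p hp => congrArg Prod.fst (hιΦ p hp)
  have hιg : ∀ p ∈ V, g (ι p) = 1 := fun p hp => by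
    have h1 := hιu p hp
    have h2 : Real.log (g (ι p)) = 0 := (mul_eq_zero.1 h1).resolve_left (div_ne_zero hb hμ)
    rw [← Real.exp_log (hs.pos _ (hιW p hp)), h2, Real.exp_zero]
  have hdι : ∀ p ∈ V, ∀ v, fderiv ℝ ι p v = fderiv ℝ Φ.symm (0, p) (0, v) := fun p hp v => by
    have h1 := ((differentiableAt_of_infty (hsymmc _ (hmem 0 h0mem p hp))).hasFDerivAt.comp p
      (hasFDerivAt_prodMk_right (𝕜 := ℝ) (0 : ℝ) p)).fderiv
    exact congrArg (fun L : E₁ →L[ℝ] E => L v) h1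
  have hιchain : ∀ p ∈ V, ∀ v, fderiv ℝ Φ₀ (ι p) (fderiv ℝ ι p v) = (0, v) := fun p hp v => by
    rw [hdι p hp]; exact hchain _ (hmem 0 h0mem p hp) _
  have hι : IsOrthogonalSlice ε f U T V ι := by
    refine ⟨fun p hp => ?_, fun p hp => hWU (hιW p hp), fun p hp v v' h => ?_, fun p hp e => ?_⟩
    · exact ((hsymmc _ (hmem 0 h0mem p hp)).comp p
        (contDiffAt_const.prodMk contDiffAt_id)).contDiffWithinAt
    · have h1 := hιchain p hp v
      rw [h, hιchain p hp v'] at h1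
      exact (congrArg Prod.snd h1).symm
    · constructor
      · rintro ⟨v, rfl⟩
        have h1 := congrArg Prod.fst (hιchain p hp v)
        rw [hdΦ₀ _ (hιW p hp), hdu _ (hιW p hp)] at h1
        exact (mul_eq_zero.1 h1).resolve_left hb
      · intro he
        refine ⟨(fderiv ℝ Φ₀ (ι p) e).2, ?_⟩
        refine (hΦinv _ (Φ.map_target (hmem 0 h0mem p hp))).injective ?_
        refine (hιchain p hp _).trans (Prod.ext ?_ rfl)
        rw [hdΦ₀ _ (hιW p hp), hdu _ (hιW p hp), he, mul_zero]
  have hB : IsSliceProjection f T b V ι B := by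
    refine ⟨fun p hp => hBT _ (hιW p hp), fun p hp y hy => ⟨(μ - b)⁻¹ * β y, ?_⟩⟩
    conv_lhs => rw [hBker y hy]
    rw [hs.tangent _ (hιW p hp), hιg p hp, add_sub_cancel_left, mul_one, smul_smul]
    congr 1
    field_simp
  have hconst : ∀ t ∈ Set.Ioo (-r) r, ∀ p ∈ V, f₁ (Φ.symm (t, p)) = f₁ (ι p) := by
    intro t ht p hp
    have hder : ∀ s ∈ Set.Ioo (-r) r, HasDerivAt (fun s => f₁ (Φ.symm (s, p))) 0 s := by
      intro s hs'
      have hy := hmem s hs' p hp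
      have hx := hΦW (Φ.map_target hy)
      have h1 := ((differentiableAt_of_infty (hf₁c _ hx)).hasFDerivAt.comp (s, p)
        (differentiableAt_of_infty (hsymmc _ hy)).hasFDerivAt).comp_hasDerivAt s
        ((hasDerivAt_id s).prodMk (hasDerivAt_const s p))
      -- The coordinate field of `u` is `T / b`, as `du(T) = b` and `df₁(T) = 0`.
      have h2 : b • fderiv ℝ Φ.symm (s, p) (1, 0) = T (Φ.symm (s, p)) := by
        refine (hΦinv _ (Φ.map_target hy)).injective ?_
        rw [map_smul, hchain _ hy, hdΦ₀ _ hx, hdf₁T _ hx, map_zero, hdu _ hx,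
          hT.unit _ (hWU hx)]
        simp
      have h3 : fderiv ℝ f₁ (Φ.symm (s, p)) (fderiv ℝ Φ.symm (s, p) (1, 0)) = 0 := by
        have h4 := hdf₁T _ hx
        rw [← h2, map_smul] at h4
        exact (smul_eq_zero.1 h4).resolve_left hb
      rw [ContinuousLinearMap.comp_apply, h3] at h1
      exact h1
    exact isOpen_Ioo.is_const_of_deriv_eq_zero isPreconnected_Ioo
      (fun s hs' => (hder s hs').differentiableAt.differentiableWithinAt)
      (fun s hs' => (hder s hs').deriv) ht h0mem
  have hεb : ε - b ^ 2 ≠ 0 := by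
    rw [hε, show b * μ - b ^ 2 = b * (μ - b) by ring]
    exact mul_ne_zero hb hμb
  -- `ε₁` is the sign of `ε - b² = b (μ - b)`, which makes the metric of the factor positive
  -- definite.
  obtain ⟨ε₁, hε₁, hκ⟩ : ∃ ε₁ : ℝ, (ε₁ = 1 ∨ ε₁ = -1) ∧ ε₁ * |ε - b ^ 2| = ε - b ^ 2 := by
    rcases lt_or_gt_of_ne hεb with h | h
    · exact ⟨-1, Or.inr rfl, by rw [abs_of_neg h]; ring⟩
    · exact ⟨1, Or.inl rfl, by rw [abs_of_pos h, one_mul]⟩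
  have hκ0 := abs_pos.2 hεb
  -- From `u = (b/μ) log g` one gets `g = e^{(μ/b) u}`; the constant avoids `-1` because `μ ≠ b`.
  refine ⟨-(μ / b), ε₁, -r, r, V, fun p => B (f (ι p)), A, Φ, ?_, ?_, hVo,
    hι.isConvexCentroaffineOn hVo hT hf hU hK hB hEF hε₁ hκ hκ0,
    fun p hp => hι.covDerivCubicForm_projection hVo hT hf hU hK hB hEF hε₁ hκ hκ0 hp,
    hxΦ, hΦW.trans hWU, hΦt, ?_, hΦs, fun x hx => ?_⟩
  · exact neg_ne_zero.2 (div_ne_zero hμ hb)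
  · rw [Ne, neg_inj, div_eq_one_iff_eq hb]
    exact fun h => hμb (sub_eq_zero.2 h)
  · exact (hΦ₀c.mono hΦW).congr fun x _ => hΦ x
  · have hxW := hΦW hx
    have hy : Φ₀ x ∈ Set.Ioo (-r) r ×ˢ V := by rw [← hΦt, ← hΦ]; exact Φ.map_source hx
    have h1 := hconst _ hy.1 _ hy.2
    have h2 : Φ.symm ((Φ₀ x).1, (Φ₀ x).2) = x := by
      rw [Prod.mk.eta, ← hΦ, Φ.left_inv hx]
    rw [h2] at h1
    simp only [hf₁, hιu _ hy.2, neg_zero, Real.exp_zero, one_smul] at h1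
    rw [hA, hs.apply_pos x hxW, hΦ, calabiPoint]
    refine Prod.ext ?_ ?_
    · change B (f x) = Real.exp (u x) • B (f (ι (Φ₀ x).2))
      rw [← h1, smul_smul, ← Real.exp_add, add_neg_cancel, Real.exp_zero, one_smul]
    · change g x = Real.exp (- -(μ / b) * (b / μ * Real.log (g x)))
      rw [neg_neg, ← mul_assoc, div_mul_div_cancel₀ hb, div_self hμ, one_mul,
        Real.exp_log (hs.pos x hxW)]

end LocalDecomposition

/-! ### Passage from the manifold to a chart. -/

section Manifold

theorem IsPrincipalField.mono {E F : Type*} [NormedAddCommGroup E] [NormedSpace ℝ E]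
    [NormedAddCommGroup F] [NormedSpace ℝ F] {ε : ℝ} {f : E → F} {U V : Set E} {T : E → E}
    {a b : E → ℝ} (hT : IsPrincipalField ε f U T a b) (h : V ⊆ U) :
    IsPrincipalField ε f V T a b :=
  ⟨hT.smooth.mono h, fun x hx => hT.unit x (h hx), fun x hx => hT.eigen x (h hx),
    fun x hx => hT.eigen_orth x (h hx), fun x hx => hT.ne x (h hx)⟩

variable {n : ℕ} {M : Type*} [TopologicalSpace M] [ChartedSpace (EuclideanSpace ℝ (Fin n)) M]
  [IsManifold (𝓡 n) ∞ M]

/-- The chart components of `T` are its components in the tangent bundle trivialization at `p`. -/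
theorem contDiffOn_coordVec {T : ∀ q : M, TangentSpace (𝓡 n) q}
    (hT : ContMDiff (𝓡 n) (𝓡 n).tangent ∞ (fun q => (⟨q, T q⟩ : TangentBundle (𝓡 n) M)))
    (p : M) :
    ContDiffOn ℝ ∞ (fun x => coordVec p ((extChartAt (𝓡 n) p).symm x)
      (T ((extChartAt (𝓡 n) p).symm x))) (extChartAt (𝓡 n) p).target := by
  have : IsManifold (𝓡 n) 1 M := IsManifold.of_le (n := ∞) (by simp)
  have h1 := ((trivializationAt (EuclideanSpace ℝ (Fin n)) (TangentSpace (𝓡 n))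
    p).contMDiffOn_section_baseSet_iff (IB := 𝓡 n) (n := ∞) (s := T)).1 hT.contMDiffOn
  rw [← contMDiffOn_iff_contDiffOn]
  have h2 := (h1.congr (f₁ := fun q => coordVec p q (T q)) ?_).comp
    (contMDiffOn_extChartAt_symm p) ?_
  · exact h2
  · intro q hq
    have hq' : q ∈ (chartAt (EuclideanSpace ℝ (Fin n)) p).source := by simpa using hq
    have h : (trivializationAt (EuclideanSpace ℝ (Fin n)) (TangentSpace (𝓡 n))
        p).continuousLinearMapAt ℝ q (T q) = (trivializationAt (EuclideanSpace ℝ (Fin n))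
        (TangentSpace (𝓡 n)) p ⟨q, T q⟩).2 := by
      rw [Bundle.Trivialization.continuousLinearMapAt_apply,
        Bundle.Trivialization.linearMapAt_apply, if_pos hq]
    exact (DFunLike.congr_fun
      (TangentBundle.continuousLinearMapAt_trivializationAt hq') (T q)).symm.trans h
  · intro x hx
    simpa using (extChartAt (𝓡 n) p).map_target hx

theorem isPrincipalField_coord {F : Type*} [NormedAddCommGroup F] [NormedSpace ℝ F]
    {ε : ℝ} {ψ : M → F} (hn : 1 ≤ n)
    {T : ∀ q : M, TangentSpace (𝓡 n) q}
    (hT : ContMDiff (𝓡 n) (𝓡 n).tangent ∞ (fun q => (⟨q, T q⟩ : TangentBundle (𝓡 n) M)))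
    {D₂ : ∀ q : M, Submodule ℝ (TangentSpace (𝓡 n) q)}
    (hD₂ : ∀ q, Module.finrank ℝ (D₂ q) = n - 1)
    {lam₁ lam₂ : M → ℝ} (hlam : ∀ q, lam₁ q ≠ 2 * lam₂ q) (p : M)
    (hunit : ∀ q ∈ (chartAt (EuclideanSpace ℝ (Fin n)) p).source,
      metricAt ε ψ p q (T q) (T q) = 1)
    (horth : ∀ q ∈ (chartAt (EuclideanSpace ℝ (Fin n)) p).source, ∀ v ∈ D₂ q,
      metricAt ε ψ p q (T q) v = 0)
    (hKT : ∀ q ∈ (chartAt (EuclideanSpace ℝ (Fin n)) p).source,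
      diffTensorAt ε ψ p q (T q) (T q) = lam₁ q • coordVec p q (T q))
    (hKV : ∀ q ∈ (chartAt (EuclideanSpace ℝ (Fin n)) p).source, ∀ v ∈ D₂ q,
      diffTensorAt ε ψ p q (T q) v = lam₂ q • coordVec p q v) :
    IsPrincipalField ε (coordRep ψ p) (extChartAt (𝓡 n) p).target
      (fun x => coordVec p ((extChartAt (𝓡 n) p).symm x) (T ((extChartAt (𝓡 n) p).symm x)))
      (fun x => lam₁ ((extChartAt (𝓡 n) p).symm x))
      (fun x => lam₂ ((extChartAt (𝓡 n) p).symm x)) := by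
  have : IsManifold (𝓡 n) 1 M := IsManifold.of_le (n := ∞) (by simp)
  have hsrc : ∀ x ∈ (extChartAt (𝓡 n) p).target, (extChartAt (𝓡 n) p).symm x ∈
      (chartAt (EuclideanSpace ℝ (Fin n)) p).source := fun x hx => by
    simpa using (extChartAt (𝓡 n) p).map_target hx
  have hinv : ∀ x ∈ (extChartAt (𝓡 n) p).target,
      extChartAt (𝓡 n) p ((extChartAt (𝓡 n) p).symm x) = x := fun x hx =>
    (extChartAt (𝓡 n) p).right_inv hx
  refine ⟨contDiffOn_coordVec hT p, fun x hx => ?_, fun x hx => ?_, fun x hx v hv => ?_,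
    fun x _ => hlam _⟩
  · have h := hunit _ (hsrc x hx)
    rwa [metricAt, hinv x hx] at h
  · have h := hKT _ (hsrc x hx)
    rw [diffTensorAt, hinv x hx] at h
    rw [diffTensorL_apply, h]
  · set q := (extChartAt (𝓡 n) p).symm x with hq
    have hq' := hsrc x hx
    let D : TangentSpace (𝓡 n) q →ₗ[ℝ] EuclideanSpace ℝ (Fin n) :=
      (mfderiv (𝓡 n) 𝓘(ℝ, EuclideanSpace ℝ (Fin n)) (extChartAt (𝓡 n) p) q).toLinearMap
    have hD : ∀ v, D v = coordVec p q v := fun v => rfl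
    have hinj : Function.Injective D :=
      (isInvertible_mfderiv_extChartAt (I := 𝓡 n) (x := p) (y := q)
        (by rwa [extChartAt_source])).injective
    set η := metric ε (coordRep ψ p) x (coordVec p q (T q)) with hη
    have hle : (D₂ q).map D ≤ η.ker := by
      rintro _ ⟨v, hv, rfl⟩
      have h := horth q hq' v hv
      rw [metricAt, hinv x hx] at h
      exact h
    have hη1 : η (coordVec p q (T q)) = 1 := by
      have h := hunit q hq'
      rwa [metricAt, hinv x hx] at h
    have hk : Module.finrank ℝ η.ker = n - 1 := by
      have h1 := LinearMap.finrank_range_add_finrank_ker η.toLinearMap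
      have h2 : η.toLinearMap.range = ⊤ := LinearMap.range_eq_top.2 fun s =>
        ⟨s • coordVec p q (T q), by simp [hη1]⟩
      rw [h2, finrank_top, Module.finrank_self, finrank_euclideanSpace_fin] at h1
      change Module.finrank ℝ η.toLinearMap.ker = n - 1
      omega
    -- Both spaces have dimension `n - 1`, so the image of `D₂` is the whole orthogonal complement
    -- of `T`.
    have heq : (D₂ q).map D = η.ker := by
      refine Submodule.eq_of_le_of_finrank_eq hle ?_
      rw [hk, ← hD₂ q]
      exact (Submodule.equivMapOfInjective D hinj (D₂ q)).finrank_eq.symm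
    have hmem : v ∈ (D₂ q).map D := by rw [heq]; exact hv
    obtain ⟨v, hvD, rfl⟩ := hmem
    have h := hKV q hq' v hvD
    rw [diffTensorAt, hinv x hx] at h
    rw [diffTensorL_apply, hD, h]

end Manifold

end Centroaffine

theorem theorem3p4 {n : ℕ} (hn : 2 ≤ n)
    {M : Type*} [TopologicalSpace M] [ChartedSpace (EuclideanSpace ℝ (Fin n)) M]
    [IsManifold (𝓡 n) ∞ M]
    (ε : ℝ) (ψ : M → EuclideanSpace ℝ (Fin (n + 1)))
    (hψ : Centroaffine.IsConvexCentroaffine (n := n) ε ψ)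
    (hK : Centroaffine.HasParallelDiffTensor (n := n) ε ψ)
    (T : ∀ q : M, TangentSpace (𝓡 n) q)
    (hT : ContMDiff (𝓡 n) (𝓡 n).tangent ∞ (fun q => (⟨q, T q⟩ : TangentBundle (𝓡 n) M)))
    (D₂ : ∀ q : M, Submodule ℝ (TangentSpace (𝓡 n) q))
    (hD₂ : ∀ q, Module.finrank ℝ (D₂ q) = n - 1)
    (lam₁ lam₂ : M → ℝ)
    (hlam : ∀ q, lam₁ q ≠ 2 * lam₂ q)
    (hunit : ∀ p : M, ∀ q ∈ (chartAt (EuclideanSpace ℝ (Fin n)) p).source,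
      Centroaffine.metricAt (n := n) ε ψ p q (T q) (T q) = 1)
    (horth : ∀ p : M, ∀ q ∈ (chartAt (EuclideanSpace ℝ (Fin n)) p).source, ∀ v ∈ D₂ q,
      Centroaffine.metricAt (n := n) ε ψ p q (T q) v = 0)
    (hKT : ∀ p : M, ∀ q ∈ (chartAt (EuclideanSpace ℝ (Fin n)) p).source,
      Centroaffine.diffTensorAt (n := n) ε ψ p q (T q) (T q) = lam₁ q • Centroaffine.coordVec (n := n) p q (T q))
    (hKV : ∀ p : M, ∀ q ∈ (chartAt (EuclideanSpace ℝ (Fin n)) p).source, ∀ v ∈ D₂ q,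
      Centroaffine.diffTensorAt (n := n) ε ψ p q (T q) v = lam₂ q • Centroaffine.coordVec (n := n) p q v) :
    ∀ p₀ : M, Centroaffine.IsCalabiProductWithPointNear ψ p₀ := by
  intro p₀
  have hU₀ : IsOpen (extChartAt (𝓡 n) p₀).target := isOpen_extChartAt_target p₀
  have hx₀ := mem_extChartAt_target (I := 𝓡 n) p₀
  -- A ball is connected, so the eigenvalues are constant on it.
  obtain ⟨R, hR, hball⟩ := Metric.isOpen_iff.1 hU₀ _ hx₀
  have hf := (hψ.2 p₀).mono hball
  have hKU := fun x hx => hK p₀ x (hball hx)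
  have hdim : 2 ≤ Module.finrank ℝ (EuclideanSpace ℝ (Fin n)) := by simpa using hn
  obtain ⟨a, b, hT'⟩ := ((Centroaffine.isPrincipalField_coord (by omega) hT hD₂ hlam p₀ (hunit p₀)
    (horth p₀) (hKT p₀) (hKV p₀)).mono hball).exists_const hf Metric.isOpen_ball
    (convex_ball _ R).isPreconnected hdim hKU
  have hx₀U := Metric.mem_ball_self (x := extChartAt (𝓡 n) p₀ p₀) hR
  obtain ⟨c, ε₁, r, s, V, ψ₁, A, Φ, hc0, hc1, hV, hψ₁, hC, hmem, hsub, htarget, hsm, hsm', heq⟩ :=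
    hT'.exists_local_decomposition (E₁ := EuclideanSpace ℝ (Fin (n - 1)))
      (F₁ := EuclideanSpace ℝ (Fin n)) hf Metric.isOpen_ball
      (hT'.eps_eq hf Metric.isOpen_ball hdim hx₀U hKU) hKU
      (by simp only [finrank_euclideanSpace_fin]; omega) (by simp)
      (by simp only [finrank_euclideanSpace_fin]; omega) hx₀U
  have hsub' : Φ.source ⊆ (extChartAt (𝓡 n) p₀).target := hsub.trans hball
  have htgt : ∀ x ∈ Φ.source, x ∈ (chartAt (EuclideanSpace ℝ (Fin n)) p₀).target := fun x hx => by
    simpa using hsub' hx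
  let e := chartAt (EuclideanSpace ℝ (Fin n)) p₀
  have hsymm : ContMDiffOn 𝓘(ℝ, ℝ × EuclideanSpace ℝ (Fin (n - 1)))
      𝓘(ℝ, EuclideanSpace ℝ (Fin n)) ∞ Φ.symm Φ.target := hsm'.contMDiffOn
  have hmap : ContMDiffOn 𝓘(ℝ, EuclideanSpace ℝ (Fin n))
      𝓘(ℝ, ℝ × EuclideanSpace ℝ (Fin (n - 1))) ∞ Φ Φ.source := hsm.contMDiffOn
  have htrans : (e.trans Φ).target = Φ.target := by
    rw [OpenPartialHomeomorph.trans_target]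
    exact Set.inter_eq_left.2 fun y hy => htgt _ (Φ.map_target hy)
  refine ⟨c, ε₁, r, s, V, ψ₁, A, e.trans Φ, hc0, hc1, hV, hψ₁, hC, ?_, htrans.trans htarget,
    ?_, ?_, fun q hq => ?_⟩
  · rw [OpenPartialHomeomorph.trans_source]
    exact ⟨mem_chart_source _ p₀, hmem⟩
  · rw [OpenPartialHomeomorph.trans_source]
    exact hmap.comp ((contMDiffOn_extChartAt (I := 𝓡 n) (x := p₀)).mono Set.inter_subset_left)
      fun q hq => hq.2
  · rw [htrans]
    exact (contMDiffOn_extChartAt_symm (I := 𝓡 n) p₀).comp hsymm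
      fun y hy => hsub' (Φ.map_target hy)
  · rw [OpenPartialHomeomorph.trans_source] at hq
    have h := heq (e q) hq.2
    have hleft : Centroaffine.coordRep ψ p₀ (e q) = ψ q :=
      congrArg ψ ((extChartAt (𝓡 n) p₀).left_inv (by rw [extChartAt_source]; exact hq.1))
    rw [hleft] at h
    exact h
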